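/- Let $\Bbbk\in\{\mathbb R,\mathbb C\}$, let $n\ge 2$, and let $\gamma\colon I\to\Bbbk$ be a continuous injection defined on an interval $I\subseteq\mathbb R$ (open, closed or half-open, bounded or not), with image the simple curve $\Lambda=\gamma(I)\subseteq\Bbbk\subseteq\mathbb C$. Write $\mathcal H^{\circ}(\Bbbk)$ for the set of all $n\times n$ matrices over $\Bbbk$ whose complex spectrum is contained in $\Lambda$, and $\mathcal H^{ss}(\Bbbk)$, $\mathcal H^{*}(\Bbbk)$ for the subsets of those which are semisimple (diagonalizable over $\mathbb C$), respectively normal. For invertible $T$ put $\mathrm{Ad}_T X=TXT^{-1}$. Consider the following maps from $\mathcal H^{ss}(\Bbbk)$ to $M_n(\mathbb C)$: (a) $X\mapsto \mathrm{Ad}_T X$ and $X\mapsto \mathrm{Ad}_T X^{t}$, for $T\in GL(n,\mathbb C)$; (b) $X\mapsto \mathrm{Ad}_T\,\mathrm{diag}(\lambda_1(X),\dots,\lambda_n(X))$, for $T\in GL(n,\mathbb C)$, where $\lambda_1(X),\dots,\lambda_n(X)$ are the eigenvalues of $X$ with multiplicity, ordered so that $\gamma^{-1}\lambda_i(X)$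 is non-decreasing in $i$; (c) $X=\mathrm{Ad}_R N\mapsto X^{\rho}:=\mathrm{Ad}_{R^{-1}}N$, where $N\in\mathcal H^{*}(\Bbbk)$ and $R$ is a positive (self-adjoint with positive spectrum) invertible matrix over $\Bbbk$. By a composition we mean a map of type (a), (b) or (c) on $\mathcal H^{ss}(\Bbbk)$ followed by finitely many (possibly no) maps of these types on $\mathcal H^{ss}(\mathbb C)$, the latter formed with $\gamma$ regarded as a curve in $\mathbb C$. For $f\colon\Lambda\to\mathbb C$ define $\Delta^0f=f$ and, for $k\ge 1$ and distinct $x_0,\dots,x_k\in\Lambda$, $$\Delta^kf(x_0,\dots,x_k)=\frac{\Delta^{k-1}f(x_1,\dots,x_k)-\Delta^{k-1}f(x_0,\dots,x_{k-1})}{x_k-x_0}.$$ The function $f$ is $DB^n$ on $\Lambda$ if, for every cluster point $x\in\Lambda$ of $\Lambda$, $\Delta^{n-1}f$ is bounded on the $n$-tuples of distinct points of $\Lambda$ in some neighbourhood of $(x,\dots,x)$; it is $DC^n$ on $\Lambda$ if, for every such $x$, $\Delta^{n-1}f$ has a finite limit at $(x,\dots,x)$ along the $n$-tuples of distinct points of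 $\Lambda$. Then: (1) every element of $\mathcal H^{ss}(\Bbbk)$ is of the form $\mathrm{Ad}_RN$ with $N\in\mathcal H^{*}(\Bbbk)$ and $R$ positive invertible over $\Bbbk$, and conversely; $(-)^{\rho}$ is a well-defined involution of $\mathcal H^{ss}(\Bbbk)$; and all compositions take values in $\mathcal H^{ss}(\mathbb C)$, preserve commutativity (commuting matrices have commuting images) and preserve spectra (as sets, and also with multiplicities). If moreover $\gamma$ is a homeomorphism onto $\Lambda$, then: (2) the compositions are all continuous on $\mathcal H^{ss}(\Bbbk)$ if and only if complex conjugation is $DB^n$ on $\Lambda$; (3) the compositions all extend to continuous maps $\mathcal H^{\circ}(\Bbbk)\to M_n(\mathbb C)$ if and only if complex conjugation is $DC^n$ on $\Lambda$. -/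

import Mathlib

open Filter Topology
open scoped ComplexOrder

namespace CurveSpectra

/-! ### Divided differences -/

/-- The difference-quotient operator, sending a function of `k` variables to the function
`(x₀, …, x_k) ↦ (f (x₁, …, x_k) - f (x₀, …, x_{k-1})) / (x_k - x₀)` of `k + 1` variables. It is
only used at tuples with distinct entries. -/
noncomputable def diffQuot {k : ℕ} (f : (Fin k → ℂ) → ℂ) (x : Fin (k + 1) → ℂ) : ℂ :=
  (f (fun i => x i.succ) - f (fun i => x i.castSucc)) / (x (Fin.last k) - x 0)

/-- The `k`-fold iterate `Δ^k f` of the difference-quotient operator, applied to a function `f`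
of one variable; a function of `k + 1` variables. -/
noncomputable def iterDiffQuot (f : ℂ → ℂ) : (k : ℕ) → (Fin (k + 1) → ℂ) → ℂ
  | 0 => fun x => f (x 0)
  | k + 1 => diffQuot (iterDiffQuot f k)

/-- The configuration space of `k`-tuples of distinct points of `Λ`. -/
def configSpace (k : ℕ) (Λ : Set ℂ) : Set (Fin k → ℂ) :=
  {x | Function.Injective x ∧ ∀ i, x i ∈ Λ}

/-- `f` is DB^n on `Λ` (for `n ≥ 1`): the `n`-variable function `Δ^{n-1} f` on the configuration
space is bounded locally around `(x, …, x)` for every cluster point `x ∈ Λ` of `Λ`. -/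
def IsDB (n : ℕ) (f : ℂ → ℂ) (Λ : Set ℂ) : Prop :=
  ∀ x ∈ Λ, AccPt x (𝓟 Λ) →
    ∃ C : ℝ, ∀ᶠ y in 𝓝[configSpace (n - 1 + 1) Λ] (fun _ => x), ‖iterDiffQuot f (n - 1) y‖ ≤ C

/-- `f` is DC^n on `Λ` (for `n ≥ 1`): the `n`-variable function `Δ^{n-1} f` on the configuration
space has a finite limit at `(x, …, x)` for every cluster point `x ∈ Λ` of `Λ`. -/
def IsDC (n : ℕ) (f : ℂ → ℂ) (Λ : Set ℂ) : Prop :=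
  ∀ x ∈ Λ, AccPt x (𝓟 Λ) →
    ∃ L : ℂ, Tendsto (iterDiffQuot f (n - 1)) (𝓝[configSpace (n - 1 + 1) Λ] (fun _ => x)) (𝓝 L)

/-! ### Spaces of matrices with spectrum in `Λ` -/

variable {𝕜 : Type*} [RCLike 𝕜] {n : ℕ}

/-- A matrix over `𝕜 ∈ {ℝ, ℂ}`, regarded as a complex matrix. -/
noncomputable def toComplex (X : Matrix (Fin n) (Fin n) 𝕜) : Matrix (Fin n) (Fin n) ℂ :=
  X.map (RCLike.map 𝕜 ℂ)

/-- Matrices over `𝕜` with (complex) spectrum contained in `Λ`. -/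
def arbMatrices (𝕜 : Type*) [RCLike 𝕜] (n : ℕ) (Λ : Set ℂ) : Set (Matrix (Fin n) (Fin n) 𝕜) :=
  {X | spectrum ℂ (toComplex X) ⊆ Λ}

/-- Semisimple matrices, i.e. diagonalizable over `ℂ`, with spectrum contained in `Λ`. -/
def ssMatrices (𝕜 : Type*) [RCLike 𝕜] (n : ℕ) (Λ : Set ℂ) : Set (Matrix (Fin n) (Fin n) 𝕜) :=
  {X | X ∈ arbMatrices 𝕜 n Λ ∧ ∃ (P : GL (Fin n) ℂ) (d : Fin n → ℂ),
    toComplex X = (P : Matrix (Fin n) (Fin n) ℂ) * Matrix.diagonal d *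
      ((P⁻¹ : GL (Fin n) ℂ) : Matrix (Fin n) (Fin n) ℂ)}

/-- Normal matrices over `𝕜` with spectrum contained in `Λ`. -/
def normalMatrices (𝕜 : Type*) [RCLike 𝕜] (n : ℕ) (Λ : Set ℂ) :
    Set (Matrix (Fin n) (Fin n) 𝕜) :=
  {X | X ∈ arbMatrices 𝕜 n Λ ∧ IsStarNormal X}

/-! ### The maps -/

/-- Conjugation `Ad_T = T (-) T⁻¹`. -/
def Ad (T : GL (Fin n) ℂ) (X : Matrix (Fin n) (Fin n) ℂ) : Matrix (Fin n) (Fin n) ℂ :=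
  (T : Matrix (Fin n) (Fin n) ℂ) * X * ((T⁻¹ : GL (Fin n) ℂ) : Matrix (Fin n) (Fin n) ℂ)

open Classical in
/-- The eigenvalues `λ₁(X), …, λ_n(X)`, with multiplicity, of a matrix `X` whose spectrum is on
the curve `γ`, arranged so that the parameters `γ⁻¹ λ_i(X)` are non-decreasing in `i`
(the value is irrelevant when the spectrum of `X` is not on the curve). -/
noncomputable def orderedSpectrum {I : Set ℝ} (γ : I → ℂ) (X : Matrix (Fin n) (Fin n) ℂ) :
    Fin n → ℂ :=
  if h : ∃ t : Fin n → I, Monotone t ∧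
      X.charpoly.roots = Multiset.map (fun i => γ (t i)) Finset.univ.val
  then fun i => γ (h.choose i)
  else 0

open Classical in
/-- The map `(-)^ρ`, sending `X = R N R⁻¹`, for `N` normal with spectrum in `Λ` and `R` positive
invertible (both over `𝕜`), to `R⁻¹ N R`. The value is irrelevant when `X` has no such
decomposition. -/
noncomputable def rho (Λ : Set ℂ) (X : Matrix (Fin n) (Fin n) 𝕜) : Matrix (Fin n) (Fin n) 𝕜 :=
  if h : ∃ p : Matrix (Fin n) (Fin n) 𝕜 × Matrix (Fin n) (Fin n) 𝕜,
      p.1.PosDef ∧ p.2 ∈ normalMatrices 𝕜 n Λ ∧ X = p.1 * p.2 * p.1⁻¹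
  then h.choose.1⁻¹ * h.choose.2 * h.choose.1
  else 0

/-- The basic maps, from matrices over `𝕜` to complex matrices, attached to a curve `γ`:
conjugations, transpose conjugations, conjugated ordered spectra, and `(-)^ρ`. -/
inductive IsBasic {I : Set ℝ} (γ : I → ℂ) :
    (Matrix (Fin n) (Fin n) 𝕜 → Matrix (Fin n) (Fin n) ℂ) → Prop
  | conj (T : GL (Fin n) ℂ) : IsBasic γ (fun X => Ad T (toComplex X))
  | transposeConj (T : GL (Fin n) ℂ) : IsBasic γ (fun X => Ad T (toComplex X).transpose)
  | spec (T : GL (Fin n) ℂ) :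
      IsBasic γ (fun X => Ad T (Matrix.diagonal (orderedSpectrum γ (toComplex X))))
  | rho : IsBasic γ (fun X => toComplex (rho (Set.range γ) X))

/-- Compositions of basic maps. The first one is applied to matrices over `𝕜`, the following ones
to complex matrices. -/
inductive IsComposition {I : Set ℝ} (γ : I → ℂ) :
    (Matrix (Fin n) (Fin n) 𝕜 → Matrix (Fin n) (Fin n) ℂ) → Prop
  | basic {φ : Matrix (Fin n) (Fin n) 𝕜 → Matrix (Fin n) (Fin n) ℂ} :
      IsBasic γ φ → IsComposition γ φ
  | comp {φ : Matrix (Fin n) (Fin n) 𝕜 → Matrix (Fin n) (Fin n) ℂ}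
      {ψ : Matrix (Fin n) (Fin n) ℂ → Matrix (Fin n) (Fin n) ℂ} :
      IsComposition γ φ → IsBasic γ ψ → IsComposition γ (fun X => ψ (φ X))

/-- `φ` preserves commutativity on the set `S`. -/
def PreservesCommutativity (S : Set (Matrix (Fin n) (Fin n) 𝕜))
    (φ : Matrix (Fin n) (Fin n) 𝕜 → Matrix (Fin n) (Fin n) ℂ) : Prop :=
  ∀ X ∈ S, ∀ Y ∈ S, Commute X Y → Commute (φ X) (φ Y)

/-- `φ` preserves spectra on the set `S`, both as sets and with multiplicities. -/
def PreservesSpectrum (S : Set (Matrix (Fin n) (Fin n) 𝕜))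
    (φ : Matrix (Fin n) (Fin n) 𝕜 → Matrix (Fin n) (Fin n) ℂ) : Prop :=
  ∀ X ∈ S, spectrum ℂ (φ X) = spectrum ℂ (toComplex X) ∧
    (φ X).charpoly = (toComplex X).charpoly

/-- The restriction of `φ` to `S` extends to a continuous map on `S'`. -/
def ExtendsContinuously (S S' : Set (Matrix (Fin n) (Fin n) 𝕜))
    (φ : Matrix (Fin n) (Fin n) 𝕜 → Matrix (Fin n) (Fin n) ℂ) : Prop :=
  ∃ ψ : Matrix (Fin n) (Fin n) 𝕜 → Matrix (Fin n) (Fin n) ℂ,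
    ContinuousOn ψ S' ∧ Set.EqOn ψ φ S

end CurveSpectra

/-!
Every semisimple `X` over `𝕜` with spectrum on the curve can be written `X = P D P⁻¹` over `𝕜`, with
`D` diagonal. By the polar decomposition `P = R U` this is `R N R⁻¹` with `N = U D Uᴴ` normal, and
Fuglede–Putnam shows that `R⁻¹ N R` depends on `X` only (`inv_mul_mul_eq_of_posDef`). It equals
`(Pᴴ)⁻¹ D Pᴴ`, that is `q(X)ᴴ` for any polynomial `q` which interpolates complex conjugation on the
spectrum of `X` (`rho_conj_diagonal_eq_aeval`). So `ρ` is the functional calculus of complex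
conjugation followed by the conjugate transpose. This gives the algebraic statements. It also shows
that `ρ` commutes with complexification, so a composition over `𝕜` is a composition over `ℂ`
precomposed with complexification.

When `X` has distinct eigenvalues `y₀, …, y_{n-1}`, Newton's formula gives
`q = ∑ Δ^k (y₀, …, y_k) ∏_{i < k} (X - y_i)`, with `Δ^k` the divided differences of complex
conjugation (`eval_newtonPoly`). The eigenvalues, ordered along the curve, depend continuously on the
matrix (`tendsto_spectralParam`), and in the limit equal eigenvalues are contiguous. Hence the defining
recursion of `Δ^k` reduces its boundedness or convergence to the case where all points tend to the
same point of the curve (`exists_tendsto_divDiff_of_contiguous`), which is what `DB` and `DC` are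
about; the conditions of order `n` imply those of lower order (`IsDC_of_IsDB_succ`). Matrices with
simple spectrum are dense in all matrices with spectrum on the curve
(`arbMatrices_subset_closure_simpleMatrices`). Under `DC`, `ρ` has limits along them at every such
matrix, hence extends continuously. Under `DB`, the coefficients of `q` converge along ultrafilters,
to those of a polynomial which still interpolates complex conjugation at the eigenvalues of the limit
matrix; when that matrix is semisimple, this determines the limit, so `ρ` is continuous.

Conversely, for a bidiagonal matrix with diagonal `y₀, …, y_{n-1}` and superdiagonal `ε`, a corner
entry of the image under `ρ` is the conjugate of `ε^{n-1} Δ^{n-1} (y₀, …, y_{n-1})`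
(`rho_bidiagonal_corner`). Continuity of `ρ` at scalar matrices then bounds `Δ^{n-1}`, and continuity
of an extension at Jordan blocks, where `ε = 1`, makes it converge.

If the interval is a single point or empty, there is at most one semisimple matrix and the curve has
no cluster point.
-/

namespace CurveSpectra

/-! ### Diagonalization and triangularization of matrices -/

section LinearAlgebra

open Polynomial Matrix

variable {K : Type*} [Field K] {n : ℕ}

theorem exists_conj_diagonal_of_span_eq_top {X : Matrix (Fin n) (Fin n) K}
    (h : Submodule.span K {v : Fin n → K | ∃ μ : K, X *ᵥ v = μ • v} = ⊤) :
    ∃ (P : GL (Fin n) K) (d : Fin n → K), X = (P : Matrix (Fin n) (Fin n) K) * diagonal d *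
      ((P⁻¹ : GL (Fin n) K) : Matrix (Fin n) (Fin n) K) := by
  classical
  let b₀ := Module.Basis.ofSpan h.ge
  have hb₀ := Module.Basis.ofSpan_subset h.ge
  let e := b₀.indexEquiv (Pi.basisFun K (Fin n))
  let b := b₀.reindex e
  have hb : ∀ i, ∃ μ : K, X *ᵥ b i = μ • b i := fun i => by
    have : b i ∈ Set.range b₀ := ⟨e.symm i, by simp [b]⟩
    exact hb₀ this
  choose d hd using hb
  let P : Matrix (Fin n) (Fin n) K := (Pi.basisFun K (Fin n)).toMatrix b
  let Q : Matrix (Fin n) (Fin n) K := b.toMatrix (Pi.basisFun K (Fin n))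
  have hPQ : P * Q = 1 := Module.Basis.toMatrix_mul_toMatrix_flip _ _
  have hQP : Q * P = 1 := Module.Basis.toMatrix_mul_toMatrix_flip _ _
  refine ⟨⟨P, Q, hPQ, hQP⟩, d, ?_⟩
  have hXP : X * P = P * diagonal d := by
    ext i j
    have := congrFun (hd j) i
    simp only [mul_diagonal]
    rw [mul_apply]
    simp only [mulVec, dotProduct, Pi.smul_apply, smul_eq_mul] at this
    simp only [P, Module.Basis.toMatrix_apply, Pi.basisFun_repr]
    rw [this, mul_comm]
  change X = P * diagonal d * Q
  rw [← hXP, mul_assoc, hPQ, mul_one]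

/-- A matrix killed by a polynomial with simple roots in `K` is diagonalizable over `K`: the
Lagrange basis polynomials of the roots split each vector into eigenvectors. -/
theorem exists_conj_diagonal_of_aeval_prod_eq_zero {X : Matrix (Fin n) (Fin n) K} (s : Finset K)
    (h : aeval X (∏ a ∈ s, (Polynomial.X - C a)) = 0) :
    ∃ (P : GL (Fin n) K) (d : Fin n → K), X = (P : Matrix (Fin n) (Fin n) K) * diagonal d *
      ((P⁻¹ : GL (Fin n) K) : Matrix (Fin n) (Fin n) K) := by
  classical
  apply exists_conj_diagonal_of_span_eq_top
  rw [eq_top_iff]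
  rintro v -
  rcases s.eq_empty_or_nonempty with rfl | hs
  · have h1 : (1 : Matrix (Fin n) (Fin n) K) = 0 := by simpa using h
    have : v = 0 := by rw [← one_mulVec v, h1, zero_mulVec]
    rw [this]
    exact zero_mem _
  have hv : v = ∑ a ∈ s, aeval X (Lagrange.basis s id a) *ᵥ v := by
    rw [← sum_mulVec, ← map_sum, Lagrange.sum_basis (Set.injOn_id _) hs]
    simp
  rw [hv]
  refine Submodule.sum_mem _ fun a ha => Submodule.subset_span ⟨a, ?_⟩
  have h2 : (Polynomial.X - C a) * Lagrange.basis s id a =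
      C (Lagrange.nodalWeight s id a) * ∏ a ∈ s, (Polynomial.X - C a) := by
    rw [Lagrange.basis_eq_prod_sub_inv_mul_nodal_div ha, ← Lagrange.nodal_erase_eq_nodal_div ha]
    have := Lagrange.nodal_eq_mul_nodal_erase (v := id) ha
    rw [Lagrange.nodal_eq s] at this
    simp only [id] at this ⊢
    rw [this]
    ring
  have h3 := congrArg (aeval X) h2
  rw [map_mul, map_mul, h, mul_zero, map_sub, aeval_X, aeval_C, sub_mul, sub_eq_zero] at h3
  rw [mulVec_mulVec, h3, ← mulVec_mulVec, Algebra.algebraMap_eq_smul_one, smul_mulVec, one_mulVec]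

theorem aeval_units_conj (P : GL (Fin n) K) (Y : Matrix (Fin n) (Fin n) K) (p : K[X]) :
    aeval ((P : Matrix (Fin n) (Fin n) K) * Y *
      ((P⁻¹ : GL (Fin n) K) : Matrix (Fin n) (Fin n) K)) p =
      (P : Matrix (Fin n) (Fin n) K) * aeval Y p *
        ((P⁻¹ : GL (Fin n) K) : Matrix (Fin n) (Fin n) K) := by
  induction p using Polynomial.induction_on' with
  | add p q hp hq => simp only [map_add, hp, hq, mul_add, add_mul]
  | monomial k a =>
    simp only [aeval_monomial, Algebra.algebraMap_eq_smul_one, Units.conj_pow]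
    simp

theorem aeval_diagonal (d : Fin n → K) (p : K[X]) :
    aeval (diagonal d) p = diagonal fun i => p.eval (d i) := by
  induction p using Polynomial.induction_on' with
  | add p q hp hq => simp only [map_add, hp, hq, diagonal_add, eval_add]
  | monomial k a =>
    simp [aeval_monomial, Algebra.algebraMap_eq_smul_one, diagonal_pow, ← diagonal_smul,
      Pi.smul_def]

theorem charpoly_conj_diagonal (P : GL (Fin n) K) (d : Fin n → K) :
    ((P : Matrix (Fin n) (Fin n) K) * diagonal d *
      ((P⁻¹ : GL (Fin n) K) : Matrix (Fin n) (Fin n) K)).charpoly =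
      ∏ i, (Polynomial.X - C (d i)) := by
  rw [coe_units_inv, charpoly_units_conj, charpoly_diagonal]

theorem spectrum_subset_iff_of_charpoly {X : Matrix (Fin n) (Fin n) K} {d : Fin n → K}
    (h : X.charpoly = ∏ i, (Polynomial.X - C (d i))) (Λ : Set K) :
    spectrum K X ⊆ Λ ↔ ∀ i, d i ∈ Λ := by
  have : ∀ r, r ∈ spectrum K X ↔ ∃ i, d i = r := fun r => by
    rw [mem_spectrum_iff_isRoot_charpoly, h, IsRoot, eval_prod, Finset.prod_eq_zero_iff]
    simp [sub_eq_zero, eq_comm]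
  constructor
  · exact fun hs i => hs ((this _).2 ⟨i, rfl⟩)
  · intro hs r hr
    obtain ⟨i, rfl⟩ := (this r).1 hr
    exact hs i

theorem spectrum_eq_of_charpoly_eq {X Y : Matrix (Fin n) (Fin n) K}
    (h : X.charpoly = Y.charpoly) : spectrum K X = spectrum K Y := by
  ext r
  rw [mem_spectrum_iff_isRoot_charpoly, mem_spectrum_iff_isRoot_charpoly, h]

theorem exists_conj_diagonal_of_charpoly {X : Matrix (Fin n) (Fin n) K} {d : Fin n → K}
    (hd : Function.Injective d) (h : X.charpoly = ∏ i, (Polynomial.X - C (d i))) :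
    ∃ (P : GL (Fin n) K) (d' : Fin n → K), X = (P : Matrix (Fin n) (Fin n) K) * diagonal d' *
      ((P⁻¹ : GL (Fin n) K) : Matrix (Fin n) (Fin n) K) := by
  classical
  have h0 := aeval_self_charpoly X
  rw [h, ← Finset.prod_image (f := fun a => Polynomial.X - C a) (fun i _ j _ hij => hd hij)] at h0
  exact exists_conj_diagonal_of_aeval_prod_eq_zero _ h0

theorem map_eq_of_prod_X_sub_C_eq {d d' : Fin n → K}
    (h : ∏ i, (Polynomial.X - C (d i)) = ∏ i, (Polynomial.X - C (d' i))) :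
    Finset.univ.val.map d = Finset.univ.val.map d' := by
  have key : ∀ e : Fin n → K, (∏ i, (Polynomial.X - C (e i))).roots = Finset.univ.val.map e := by
    intro e
    rw [← roots_multiset_prod_X_sub_C (Finset.univ.val.map e), Multiset.map_map]
    rfl
  rw [← key d, h, key]

/-- Over `ℂ` every matrix is similar to an upper triangular one: a left eigenvector is moved to the
last row, and the remaining block is treated by induction. -/
theorem exists_conj_isUpperTriangular (n : ℕ) (X : Matrix (Fin n) (Fin n) ℂ) :
    ∃ (P : GL (Fin n) ℂ) (T : Matrix (Fin n) (Fin n) ℂ), T.IsUpperTriangular ∧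
      X = (P : Matrix (Fin n) (Fin n) ℂ) * T *
        ((P⁻¹ : GL (Fin n) ℂ) : Matrix (Fin n) (Fin n) ℂ) := by
  induction n with
  | zero => exact ⟨1, X, fun i => i.elim0, by simp⟩
  | succ n ih =>
    obtain ⟨μ, hμ⟩ := Module.End.exists_eigenvalue (Matrix.toLin' Xᵀ)
    obtain ⟨v, hv⟩ := hμ.exists_hasEigenvector
    have hXv : Xᵀ *ᵥ v = μ • v := by simpa using hv.apply_eq_smul
    obtain ⟨A, hA⟩ := SeparatingDual.exists_continuousLinearEquiv_apply_eq (R := ℂ)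
      (x := (Pi.single (Fin.last n) 1 : Fin (n + 1) → ℂ)) (y := v) (by simp) hv.2
    let Q : Matrix (Fin (n + 1)) (Fin (n + 1)) ℂ := (LinearMap.toMatrix' A.toLinearMap)ᵀ
    let Q' : Matrix (Fin (n + 1)) (Fin (n + 1)) ℂ := (LinearMap.toMatrix' A.symm.toLinearMap)ᵀ
    have h1 : Q * Q' = 1 := by
      simp only [Q, Q']
      rw [← transpose_mul, ← LinearMap.toMatrix'_comp]
      have : A.symm.toLinearMap ∘ₗ A.toLinearMap = LinearMap.id := by
        ext1 x
        simp
      rw [this, LinearMap.toMatrix'_id, transpose_one]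
    have h2 : Q' * Q = 1 := mul_eq_one_comm.1 h1
    have hrow : Pi.single (Fin.last n) 1 ᵥ* (Q * X * Q') = μ • Pi.single (Fin.last n) 1 := by
      have hq : Pi.single (Fin.last n) 1 ᵥ* Q = v := by
        simp only [Q]
        rw [vecMul_transpose, LinearMap.toMatrix'_mulVec]
        exact hA
      have hq' : v ᵥ* Q' = Pi.single (Fin.last n) 1 := by
        rw [← hq, vecMul_vecMul, h1, vecMul_one]
      rw [← vecMul_vecMul, ← vecMul_vecMul, hq, ← mulVec_transpose X, hXv, smul_vecMul, hq']
    set Y := Q * X * Q' with hY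
    let e : Fin n ⊕ Fin 1 ≃ Fin (n + 1) := finSumFinEquiv
    obtain ⟨R, T, hT, hRT⟩ := ih (Y.submatrix Fin.castSucc Fin.castSucc)
    let S : Matrix (Fin (n + 1)) (Fin (n + 1)) ℂ := reindex e e (fromBlocks R 0 0 1)
    let S' : Matrix (Fin (n + 1)) (Fin (n + 1)) ℂ :=
      reindex e e (fromBlocks (R⁻¹ : GL (Fin n) ℂ) 0 0 1)
    have hS : S * S' = 1 := by
      simp only [S, S', reindex_apply, submatrix_mul_equiv, fromBlocks_multiply]
      simp [-coe_units_inv]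
    have hS' : S' * S = 1 := mul_eq_one_comm.1 hS
    have hYb : Y = reindex e e (fromBlocks (Y.submatrix Fin.castSucc Fin.castSucc)
        (Y.submatrix Fin.castSucc (fun _ : Fin 1 => Fin.last n)) 0 (μ • 1)) := by
      rw [← Equiv.symm_apply_eq, reindex_symm]
      have hl : ∀ j, Y (Fin.last n) j = μ * (Pi.single (Fin.last n) 1 : Fin (n + 1) → ℂ) j := by
        intro j
        have := congrFun hrow j
        simpa using this
      have hi1 : ∀ i : Fin 1, e (Sum.inr i) = Fin.last n := fun i => by
        rw [Subsingleton.elim i 0]; rfl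
      ext (i | i) (j | j)
      · rfl
      · change Y _ (e (Sum.inr j)) = Y _ (Fin.last n)
        rw [hi1]
        rfl
      · change Y (e (Sum.inr i)) j.castSucc = 0
        rw [hi1, hl, Pi.single_eq_of_ne (Fin.castSucc_lt_last j).ne, mul_zero]
      · change Y (e (Sum.inr i)) (e (Sum.inr j)) = (μ • (1 : Matrix (Fin 1) (Fin 1) ℂ)) i j
        rw [hi1, hi1, hl, Pi.single_eq_same, Subsingleton.elim i j, Matrix.smul_apply, one_apply_eq,
          smul_eq_mul]
    have hST : S' * Y * S = reindex e e (fromBlocks T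
        ((R⁻¹ : GL (Fin n) ℂ).1 * Y.submatrix Fin.castSucc (fun _ : Fin 1 => Fin.last n)) 0
        (μ • 1)) := by
      have hT' : (R⁻¹ : GL (Fin n) ℂ).1 * (Y.submatrix Fin.castSucc Fin.castSucc * R.1) = T := by
        rw [hRT, mul_assoc, ← Units.val_mul, inv_mul_cancel, Units.val_one, mul_one, ← mul_assoc,
          ← Units.val_mul, inv_mul_cancel, Units.val_one, one_mul]
      have h3 : S' * Y * S = S' * reindex e e (fromBlocks (Y.submatrix Fin.castSucc Fin.castSucc)
          (Y.submatrix Fin.castSucc (fun _ : Fin 1 => Fin.last n)) 0 (μ • 1)) * S := by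
        rw [← hYb]
      rw [h3]
      simp only [S, S', reindex_apply, submatrix_mul_equiv, fromBlocks_multiply,
        Matrix.zero_mul, Matrix.mul_zero, Matrix.one_mul, Matrix.mul_one, add_zero, zero_add,
        Matrix.mul_assoc, hT']
    refine ⟨⟨Q' * S, S' * Q, ?_, ?_⟩, S' * Y * S, ?_, ?_⟩
    · rw [mul_assoc, ← mul_assoc S, hS, one_mul, h2]
    · rw [mul_assoc, ← mul_assoc Q, h1, one_mul, hS']
    · rw [hST]
      intro i j hij
      obtain ⟨i, rfl⟩ := e.surjective i
      obtain ⟨j, rfl⟩ := e.surjective j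
      simp only [reindex_apply, submatrix_apply, Equiv.symm_apply_apply]
      rcases i with i | i <;> rcases j with j | j
      · exact hT hij
      · have h3 : (e (Sum.inr j)).1 < (e (Sum.inl i)).1 := hij
        have h4 : (e (Sum.inr j)).1 = n + j.1 := rfl
        have h5 : (e (Sum.inl i)).1 = i.1 := rfl
        omega
      · rfl
      · rw [Subsingleton.elim i j] at hij
        exact absurd hij (lt_irrefl _)
    · change X = Q' * S * (S' * Y * S) * (S' * Q)
      calc X = (Q' * Q) * X * (Q' * Q) := by rw [h2, one_mul, mul_one]
        _ = Q' * (S * S') * Y * (S * S') * Q := by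
          rw [hS, mul_one, mul_one, hY]
          simp only [mul_assoc]
        _ = _ := by simp only [mul_assoc]

end LinearAlgebra

/-! ### Complexification -/

section Complexification

open Polynomial Matrix

variable {𝕜 : Type*} [RCLike 𝕜] {n : ℕ}

/-- The inclusion `RCLike.map 𝕜 ℂ` as a ring homomorphism. -/
noncomputable def embC (𝕜 : Type*) [RCLike 𝕜] : 𝕜 →+* ℂ where
  toFun := RCLike.map 𝕜 ℂ
  map_one' := by simp
  map_zero' := by simp
  map_add' := map_add _
  map_mul' x y := by
    apply Complex.ext <;> simp [RCLike.mul_re, RCLike.mul_im]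

theorem embC_apply (z : 𝕜) : embC 𝕜 z = RCLike.map 𝕜 ℂ z := rfl

theorem embC_injective : Function.Injective (embC 𝕜) := (embC 𝕜).injective

theorem continuous_embC : Continuous (embC 𝕜) := (RCLike.map 𝕜 ℂ).continuous

theorem embC_conj (z : 𝕜) : embC 𝕜 (starRingEnd 𝕜 z) = starRingEnd ℂ (embC 𝕜 z) := by
  apply Complex.ext <;> simp [embC_apply]

theorem embC_self (z : ℂ) : embC ℂ z = z := by simp [embC_apply]

theorem embC_leftInverse : Function.LeftInverse (RCLike.map ℂ 𝕜) (embC 𝕜) := by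
  intro z
  simp only [embC_apply, RCLike.map_apply]
  rw [← RCLike.re_add_im z]
  rcases RCLike.I_eq_zero_or_im_I_eq_one (K := 𝕜) with h | h <;> simp [h]

theorem toComplex_eq (X : Matrix (Fin n) (Fin n) 𝕜) : toComplex X = (embC 𝕜).mapMatrix X := rfl

theorem toComplex_self (X : Matrix (Fin n) (Fin n) ℂ) : toComplex X = X := by
  ext i j
  exact embC_self _

theorem toComplex_apply (X : Matrix (Fin n) (Fin n) 𝕜) (i j : Fin n) :
    toComplex X i j = embC 𝕜 (X i j) := rfl

theorem toComplex_mul (X Y : Matrix (Fin n) (Fin n) 𝕜) :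
    toComplex (X * Y) = toComplex X * toComplex Y := map_mul (embC 𝕜).mapMatrix X Y

theorem toComplex_injective :
    Function.Injective (toComplex : Matrix (Fin n) (Fin n) 𝕜 → Matrix (Fin n) (Fin n) ℂ) :=
  Matrix.map_injective embC_injective

theorem continuous_toComplex :
    Continuous (toComplex : Matrix (Fin n) (Fin n) 𝕜 → Matrix (Fin n) (Fin n) ℂ) :=
  continuous_id.matrix_map continuous_embC

theorem toComplex_conjTranspose (X : Matrix (Fin n) (Fin n) 𝕜) :
    toComplex Xᴴ = (toComplex X)ᴴ := by
  ext i j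
  exact embC_conj _

theorem toComplex_diagonal (d : Fin n → 𝕜) :
    toComplex (diagonal d) = diagonal fun i => embC 𝕜 (d i) :=
  diagonal_map (map_zero (embC 𝕜))

theorem charpoly_toComplex (X : Matrix (Fin n) (Fin n) 𝕜) :
    (toComplex X).charpoly = X.charpoly.map (embC 𝕜) :=
  charpoly_map X (embC 𝕜)

theorem toComplex_aeval_map (X : Matrix (Fin n) (Fin n) 𝕜) (p : 𝕜[X]) :
    aeval (toComplex X) (p.map (embC 𝕜)) = toComplex (aeval X p) := by
  induction p using Polynomial.induction_on' with
  | add p q hp hq =>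
    simp only [Polynomial.map_add, map_add, hp, hq]
    exact (map_add (embC 𝕜).mapMatrix _ _).symm
  | monomial k a =>
    simp only [Polynomial.map_monomial, aeval_monomial, Algebra.algebraMap_eq_smul_one,
      smul_mul_assoc, one_mul, toComplex_eq, ← map_pow]
    ext i j
    simp

/-- The inclusion of invertible matrices over `𝕜` into the complex ones. -/
noncomputable def glToComplex (P : GL (Fin n) 𝕜) : GL (Fin n) ℂ :=
  Units.map (embC 𝕜).mapMatrix.toMonoidHom P

theorem toComplex_conj_diagonal (P : GL (Fin n) 𝕜) (d : Fin n → 𝕜) :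
    toComplex ((P : Matrix (Fin n) (Fin n) 𝕜) * diagonal d *
      ((P⁻¹ : GL (Fin n) 𝕜) : Matrix (Fin n) (Fin n) 𝕜)) =
      (glToComplex P : Matrix (Fin n) (Fin n) ℂ) * diagonal (fun i => embC 𝕜 (d i)) *
      (((glToComplex P)⁻¹ : GL (Fin n) ℂ) : Matrix (Fin n) (Fin n) ℂ) := by
  rw [toComplex_mul, toComplex_mul, toComplex_diagonal]
  rfl

theorem conj_diagonal_mem_ssMatrices {Λ : Set ℂ} (P : GL (Fin n) 𝕜) {d : Fin n → 𝕜}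
    (hd : ∀ i, embC 𝕜 (d i) ∈ Λ) :
    (P : Matrix (Fin n) (Fin n) 𝕜) * diagonal d *
      ((P⁻¹ : GL (Fin n) 𝕜) : Matrix (Fin n) (Fin n) 𝕜) ∈ ssMatrices 𝕜 n Λ := by
  refine ⟨?_, glToComplex P, fun i => embC 𝕜 (d i), toComplex_conj_diagonal P d⟩
  rw [arbMatrices, Set.mem_ofPred_eq, toComplex_conj_diagonal,
    spectrum_subset_iff_of_charpoly (charpoly_conj_diagonal _ _)]
  exact hd

/-- A matrix over `𝕜` which is diagonalizable over `ℂ` with spectrum in `𝕜` is diagonalizable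
over `𝕜`. -/
theorem exists_conj_diagonal_of_mem_ssMatrices {Λ : Set ℂ} (hΛ : Λ ⊆ Set.range (embC 𝕜))
    {X : Matrix (Fin n) (Fin n) 𝕜} (hX : X ∈ ssMatrices 𝕜 n Λ) :
    ∃ (P : GL (Fin n) 𝕜) (d : Fin n → 𝕜), X = (P : Matrix (Fin n) (Fin n) 𝕜) * diagonal d *
      ((P⁻¹ : GL (Fin n) 𝕜) : Matrix (Fin n) (Fin n) 𝕜) ∧ ∀ i, embC 𝕜 (d i) ∈ Λ := by
  classical
  obtain ⟨hs, P, d, hP⟩ := hX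
  have hd : ∀ i, d i ∈ Λ := by
    rw [arbMatrices, Set.mem_ofPred_eq, hP,
      spectrum_subset_iff_of_charpoly (charpoly_conj_diagonal _ _)] at hs
    exact hs
  choose a ha using fun i => hΛ (hd i)
  have h0 : aeval X (∏ b ∈ Finset.univ.image a, (Polynomial.X - C b)) = 0 := by
    apply toComplex_injective
    rw [← toComplex_aeval_map, hP, aeval_units_conj, aeval_diagonal, toComplex_eq, map_zero]
    have : (fun i => eval (d i) (Polynomial.map (embC 𝕜)
        (∏ b ∈ Finset.univ.image a, (Polynomial.X - C b)))) = fun _ => 0 := by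
      ext i
      rw [← ha, eval_map_apply, eval_prod, Finset.prod_eq_zero (i := a i), map_zero]
      · simp
      · simp
    rw [this, diagonal_zero, mul_zero, zero_mul]
  obtain ⟨Q, e, hQ⟩ := exists_conj_diagonal_of_aeval_prod_eq_zero _ h0
  refine ⟨Q, e, hQ, ?_⟩
  rw [arbMatrices, Set.mem_ofPred_eq, hQ, toComplex_conj_diagonal,
      spectrum_subset_iff_of_charpoly (charpoly_conj_diagonal _ _)] at hs
  exact hs

end Complexification

/-! ### Normal matrices and the map `ρ` -/

section Normal

open Polynomial Matrix

variable {𝕜 : Type*} [RCLike 𝕜] {n : ℕ}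

/-- The Fuglede–Putnam theorem for matrices: `A = S N₁ᴴ - N₂ᴴ S` vanishes since the four terms of
the trace of `A Aᴴ` cancel. -/
theorem mul_conjTranspose_eq_of_isStarNormal {S N₁ N₂ : Matrix (Fin n) (Fin n) 𝕜}
    (h₁ : IsStarNormal N₁) (h₂ : IsStarNormal N₂) (h : S * N₁ = N₂ * S) :
    S * N₁ᴴ = N₂ᴴ * S := by
  have e₁ : N₁ᴴ * N₁ = N₁ * N₁ᴴ := h₁.star_comm_self
  have e₂ : N₂ᴴ * N₂ = N₂ * N₂ᴴ := h₂.star_comm_self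
  have h' : N₁ᴴ * Sᴴ = Sᴴ * N₂ᴴ := by
    have := congrArg conjTranspose h
    rwa [conjTranspose_mul, conjTranspose_mul] at this
  rw [← sub_eq_zero, ← trace_mul_conjTranspose_self_eq_zero_iff]
  have t₁ : S * N₁ᴴ * (N₁ * Sᴴ) = N₂ * (S * Sᴴ) * N₂ᴴ := by
    calc S * N₁ᴴ * (N₁ * Sᴴ) = S * (N₁ᴴ * N₁) * Sᴴ := by simp only [mul_assoc]
      _ = (S * N₁) * (N₁ᴴ * Sᴴ) := by rw [e₁]; simp only [mul_assoc]
      _ = _ := by rw [h, h']; simp only [mul_assoc]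
  have t₂ : S * N₁ᴴ * (Sᴴ * N₂) = S * Sᴴ * (N₂ᴴ * N₂) := by
    calc S * N₁ᴴ * (Sᴴ * N₂) = S * (N₁ᴴ * Sᴴ) * N₂ := by simp only [mul_assoc]
      _ = _ := by rw [h']; simp only [mul_assoc]
  have t₃ : N₂ᴴ * S * (N₁ * Sᴴ) = N₂ᴴ * N₂ * (S * Sᴴ) := by
    calc N₂ᴴ * S * (N₁ * Sᴴ) = N₂ᴴ * (S * N₁) * Sᴴ := by simp only [mul_assoc]
      _ = _ := by rw [h]; simp only [mul_assoc]
  have t₄ : N₂ᴴ * S * (Sᴴ * N₂) = N₂ᴴ * (S * Sᴴ) * N₂ := by simp only [mul_assoc]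
  simp only [conjTranspose_sub, conjTranspose_mul, conjTranspose_conjTranspose, sub_mul, mul_sub,
    t₁, t₂, t₃, t₄, trace_sub]
  rw [trace_mul_comm (N₂ * (S * Sᴴ)), ← mul_assoc, trace_mul_comm (S * Sᴴ),
    trace_mul_comm (N₂ᴴ * (S * Sᴴ)), ← mul_assoc N₂, ← e₂]
  ring

theorem eq_zero_of_isHermitian_of_pow_eq_zero {H : Matrix (Fin n) (Fin n) 𝕜} (hH : H.IsHermitian)
    (k : ℕ) (hk : H ^ (k + 1) = 0) : H = 0 := by
  induction k with
  | zero => simpa using hk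
  | succ k ih =>
    apply ih
    rw [← conjTranspose_mul_self_eq_zero, conjTranspose_pow, hH.eq, ← pow_add,
      show k + 1 + (k + 1) = k + 1 + 1 + k by ring, pow_add, hk, zero_mul]

theorem eq_zero_of_isStarNormal_of_pow_eq_zero {M : Matrix (Fin n) (Fin n) 𝕜}
    (hM : Commute Mᴴ M) (k : ℕ) (hk : M ^ k = 0) : M = 0 := by
  rw [← conjTranspose_mul_self_eq_zero]
  apply eq_zero_of_isHermitian_of_pow_eq_zero (isHermitian_conjTranspose_mul_self M) k
  rw [hM.mul_pow, pow_succ M, hk, zero_mul, mul_zero]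

theorem commute_aeval_of_commute {X Y : Matrix (Fin n) (Fin n) 𝕜} (h : Commute X Y) (p : 𝕜[X]) :
    Commute (aeval X p) Y := by
  induction p using Polynomial.induction_on' with
  | add p q hp hq => rw [map_add]; exact hp.add_left hq
  | monomial k a =>
    rw [aeval_monomial]
    have h1 : Commute (algebraMap 𝕜 (Matrix (Fin n) (Fin n) 𝕜) a) Y := Algebra.commutes a Y
    exact h1.mul_left (h.pow_left k)

theorem commute_conjTranspose {X Y : Matrix (Fin n) (Fin n) 𝕜} (h : Commute X Y) :
    Commute Xᴴ Yᴴ := by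
  have := congrArg conjTranspose h.eq
  rw [conjTranspose_mul, conjTranspose_mul] at this
  exact this.symm

/-- Normal complex matrices are diagonalizable: the polynomial with the eigenvalues as simple roots
takes a nilpotent normal value at the matrix. -/
theorem exists_conj_diagonal_of_isStarNormal {N : Matrix (Fin n) (Fin n) ℂ}
    (hN : IsStarNormal N) :
    ∃ (P : GL (Fin n) ℂ) (d : Fin n → ℂ), N = (P : Matrix (Fin n) (Fin n) ℂ) * diagonal d *
      ((P⁻¹ : GL (Fin n) ℂ) : Matrix (Fin n) (Fin n) ℂ) := by
  classical
  set m := N.charpoly.roots with hm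
  apply exists_conj_diagonal_of_aeval_prod_eq_zero m.toFinset
  set p := ∏ a ∈ m.toFinset, (Polynomial.X - C a) with hp
  have hdvd : N.charpoly ∣ p ^ Multiset.card m := by
    have h1 : N.charpoly = (m.map fun a => Polynomial.X - C a).prod :=
      ((IsAlgClosed.splits N.charpoly).eq_prod_roots_of_monic N.charpoly_monic)
    rw [h1, Finset.prod_multiset_map_count, hp, ← Finset.prod_pow]
    exact Finset.prod_dvd_prod_of_dvd _ _ fun a _ => pow_dvd_pow _ (Multiset.count_le_card _ _)
  have hN' : Commute N Nᴴ := hN.star_comm_self.symm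
  have hc : Commute (aeval N p)ᴴ (aeval N p) := by
    have h1 := commute_aeval_of_commute hN' p
    have h2 := commute_conjTranspose h1
    rw [conjTranspose_conjTranspose] at h2
    exact (commute_aeval_of_commute h2.symm p).symm
  apply eq_zero_of_isStarNormal_of_pow_eq_zero hc (Multiset.card m)
  obtain ⟨q, hq⟩ := hdvd
  rw [← map_pow, hq, map_mul, aeval_self_charpoly, zero_mul]

theorem toComplex_isStarNormal {N : Matrix (Fin n) (Fin n) 𝕜} (hN : IsStarNormal N) :
    IsStarNormal (toComplex N) := by
  constructor
  have h : Nᴴ * N = N * Nᴴ := hN.star_comm_self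
  have := congrArg toComplex h
  rwa [toComplex_mul, toComplex_mul, toComplex_conjTranspose] at this

theorem normalMatrices_subset_ssMatrices (Λ : Set ℂ) :
    normalMatrices 𝕜 n Λ ⊆ ssMatrices 𝕜 n Λ := fun _ hN =>
  ⟨hN.1, exists_conj_diagonal_of_isStarNormal (toComplex_isStarNormal hN.2)⟩

theorem conj_mem_ssMatrices {Λ : Set ℂ} {N : Matrix (Fin n) (Fin n) 𝕜}
    (hN : N ∈ ssMatrices 𝕜 n Λ) (P : GL (Fin n) 𝕜) :
    (P : Matrix (Fin n) (Fin n) 𝕜) * N *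
      ((P⁻¹ : GL (Fin n) 𝕜) : Matrix (Fin n) (Fin n) 𝕜) ∈ ssMatrices 𝕜 n Λ := by
  obtain ⟨hs, Q, d, hQ⟩ := hN
  refine ⟨?_, glToComplex P * Q, d, ?_⟩
  · have : spectrum ℂ (toComplex ((P : Matrix (Fin n) (Fin n) 𝕜) * N *
      ((P⁻¹ : GL (Fin n) 𝕜) : Matrix (Fin n) (Fin n) 𝕜))) = spectrum ℂ (toComplex N) := by
      apply spectrum_eq_of_charpoly_eq
      rw [charpoly_toComplex, charpoly_toComplex, coe_units_inv, charpoly_units_conj]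
    rw [arbMatrices, Set.mem_ofPred_eq, this]
    exact hs
  · rw [toComplex_mul, toComplex_mul, hQ, _root_.mul_inv_rev]
    simp only [Units.val_mul, mul_assoc]
    rfl

/-- The polar decomposition of an invertible matrix. -/
theorem exists_posDef_mul_unitary (P : GL (Fin n) 𝕜) :
    ∃ R U : Matrix (Fin n) (Fin n) 𝕜, R.PosDef ∧ U * Uᴴ = 1 ∧ Uᴴ * U = 1 ∧
      (P : Matrix (Fin n) (Fin n) 𝕜) = R * U := by
  open scoped MatrixOrder in
  set A : Matrix (Fin n) (Fin n) 𝕜 := P.1 * P.1ᴴ with hA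
  have hA0 : A.PosSemidef := posSemidef_self_mul_conjTranspose _
  have hR0 : (CFC.sqrt A).PosSemidef := (CFC.sqrt_nonneg A).posSemidef
  have hRR : CFC.sqrt A * CFC.sqrt A = A := CFC.sqrt_mul_sqrt_self A hA0.nonneg
  set R := CFC.sqrt A
  have hAu : IsUnit A := by
    rw [hA]
    exact P.isUnit.mul P.isUnit.star
  have hRu : IsUnit R := by
    rw [← hRR] at hAu
    rw [isUnit_iff_isUnit_det] at hAu ⊢
    rw [det_mul] at hAu
    exact isUnit_of_mul_isUnit_left hAu
  have hdet : IsUnit R.det := (isUnit_iff_isUnit_det R).1 hRu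
  have h1 : R⁻¹ * P.1 * (R⁻¹ * P.1)ᴴ = 1 := by
    rw [conjTranspose_mul, conjTranspose_nonsing_inv, hR0.1.eq]
    calc R⁻¹ * P.1 * (P.1ᴴ * R⁻¹) = R⁻¹ * A * R⁻¹ := by rw [hA]; simp only [mul_assoc]
      _ = (R⁻¹ * R) * (R * R⁻¹) := by rw [← hRR]; simp only [mul_assoc]
      _ = 1 := by rw [nonsing_inv_mul _ hdet, mul_nonsing_inv _ hdet, one_mul]
  refine ⟨R, R⁻¹ * P.1, hR0.posDef_iff_isUnit.2 hRu, h1, mul_eq_one_comm.1 h1, ?_⟩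
  rw [← mul_assoc, mul_nonsing_inv _ hdet, one_mul]

theorem unitary_conj_diagonal_isStarNormal {U : Matrix (Fin n) (Fin n) 𝕜} (hU : Uᴴ * U = 1)
    (d : Fin n → 𝕜) : IsStarNormal (U * diagonal d * Uᴴ) := by
  constructor
  change (U * diagonal d * Uᴴ)ᴴ * (U * diagonal d * Uᴴ) =
    (U * diagonal d * Uᴴ) * (U * diagonal d * Uᴴ)ᴴ
  have key : ∀ D E : Matrix (Fin n) (Fin n) 𝕜, U * D * Uᴴ * (U * E * Uᴴ) = U * (D * E) * Uᴴ := by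
    intro D E
    calc U * D * Uᴴ * (U * E * Uᴴ) = U * D * (Uᴴ * U) * E * Uᴴ := by simp only [mul_assoc]
      _ = _ := by rw [hU, mul_one]; simp only [mul_assoc]
  have h2 : (U * diagonal d * Uᴴ)ᴴ = U * diagonal (star d) * Uᴴ := by
    rw [conjTranspose_mul, conjTranspose_mul, conjTranspose_conjTranspose,
      diagonal_conjTranspose, mul_assoc]
  rw [h2, key, key, diagonal_mul_diagonal, diagonal_mul_diagonal]
  simp only [mul_comm]

theorem exists_posDef_normal_of_conj_diagonal {Λ : Set ℂ} (P : GL (Fin n) 𝕜) {d : Fin n → 𝕜}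
    (hd : ∀ i, embC 𝕜 (d i) ∈ Λ) :
    ∃ R N : Matrix (Fin n) (Fin n) 𝕜, R.PosDef ∧ N ∈ normalMatrices 𝕜 n Λ ∧
      (P : Matrix (Fin n) (Fin n) 𝕜) * diagonal d *
        ((P⁻¹ : GL (Fin n) 𝕜) : Matrix (Fin n) (Fin n) 𝕜) = R * N * R⁻¹ ∧
      (P : Matrix (Fin n) (Fin n) 𝕜)ᴴ⁻¹ * diagonal d * (P : Matrix (Fin n) (Fin n) 𝕜)ᴴ =
        R⁻¹ * N * R := by
  obtain ⟨R, U, hR, hU, hU', hP⟩ := exists_posDef_mul_unitary P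
  refine ⟨R, U * diagonal d * Uᴴ, hR, ⟨?_, unitary_conj_diagonal_isStarNormal hU' d⟩, ?_, ?_⟩
  · exact (conj_diagonal_mem_ssMatrices (⟨U, Uᴴ, hU, hU'⟩ : GL (Fin n) 𝕜) hd).1
  · rw [coe_units_inv, hP, Matrix.mul_inv_rev, inv_eq_right_inv hU]
    simp only [mul_assoc]
  · rw [hP, conjTranspose_mul, hR.1.eq, Matrix.mul_inv_rev, inv_eq_right_inv hU']
    simp only [mul_assoc]

theorem exists_posDef_normal {Λ : Set ℂ} (hΛ : Λ ⊆ Set.range (embC 𝕜))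
    {X : Matrix (Fin n) (Fin n) 𝕜} (hX : X ∈ ssMatrices 𝕜 n Λ) :
    ∃ R N : Matrix (Fin n) (Fin n) 𝕜,
      R.PosDef ∧ N ∈ normalMatrices 𝕜 n Λ ∧ X = R * N * R⁻¹ := by
  obtain ⟨P, d, rfl, hd⟩ := exists_conj_diagonal_of_mem_ssMatrices hΛ hX
  obtain ⟨R, N, hR, hN, h, -⟩ := exists_posDef_normal_of_conj_diagonal P hd
  exact ⟨R, N, hR, hN, h⟩

theorem posDef_conj_mem_ssMatrices {Λ : Set ℂ} {R N : Matrix (Fin n) (Fin n) 𝕜} (hR : R.PosDef)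
    (hN : N ∈ normalMatrices 𝕜 n Λ) : R * N * R⁻¹ ∈ ssMatrices 𝕜 n Λ := by
  have h := conj_mem_ssMatrices (normalMatrices_subset_ssMatrices Λ hN) hR.isUnit.unit
  rwa [coe_units_inv, IsUnit.unit_spec] at h

/-- `R⁻¹ N R` depends only on `R N R⁻¹`: apply Fuglede–Putnam to the intertwiner `R₂⁻¹ R₁`. -/
theorem inv_mul_mul_eq_of_posDef {R₁ N₁ R₂ N₂ : Matrix (Fin n) (Fin n) 𝕜} (hR₁ : R₁.PosDef)
    (hR₂ : R₂.PosDef) (hN₁ : IsStarNormal N₁) (hN₂ : IsStarNormal N₂)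
    (h : R₁ * N₁ * R₁⁻¹ = R₂ * N₂ * R₂⁻¹) : R₁⁻¹ * N₁ * R₁ = R₂⁻¹ * N₂ * R₂ := by
  have hd₁ : IsUnit R₁.det := (isUnit_iff_isUnit_det R₁).1 hR₁.isUnit
  have hd₂ : IsUnit R₂.det := (isUnit_iff_isUnit_det R₂).1 hR₂.isUnit
  have a₁ : R₁ * R₁⁻¹ = 1 := mul_nonsing_inv _ hd₁
  have b₁ : R₁⁻¹ * R₁ = 1 := nonsing_inv_mul _ hd₁
  have a₂ : R₂ * R₂⁻¹ = 1 := mul_nonsing_inv _ hd₂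
  have b₂ : R₂⁻¹ * R₂ = 1 := nonsing_inv_mul _ hd₂
  have hS : (R₂⁻¹ * R₁) * N₁ = N₂ * (R₂⁻¹ * R₁) := by
    calc (R₂⁻¹ * R₁) * N₁ = R₂⁻¹ * (R₁ * N₁ * R₁⁻¹) * R₁ := by
          simp only [mul_assoc, b₁, mul_one]
      _ = R₂⁻¹ * R₂ * N₂ * R₂⁻¹ * R₁ := by rw [h]; simp only [mul_assoc]
      _ = _ := by rw [b₂, one_mul, mul_assoc]
  have hF := congrArg conjTranspose (mul_conjTranspose_eq_of_isStarNormal hN₁ hN₂ hS)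
  simp only [conjTranspose_mul, conjTranspose_conjTranspose, conjTranspose_nonsing_inv,
    hR₁.1.eq, hR₂.1.eq] at hF
  calc R₁⁻¹ * N₁ * R₁ = R₁⁻¹ * (N₁ * (R₁ * R₂⁻¹)) * R₂ := by
        simp only [mul_assoc, b₂, mul_one]
    _ = R₁⁻¹ * R₁ * R₂⁻¹ * N₂ * R₂ := by rw [hF]; simp only [mul_assoc]
    _ = _ := by rw [b₁, one_mul]

theorem rho_posDef_conj {Λ : Set ℂ} {R N : Matrix (Fin n) (Fin n) 𝕜} (hR : R.PosDef)
    (hN : N ∈ normalMatrices 𝕜 n Λ) : rho Λ (R * N * R⁻¹) = R⁻¹ * N * R := by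
  have h : ∃ p : Matrix (Fin n) (Fin n) 𝕜 × Matrix (Fin n) (Fin n) 𝕜,
      p.1.PosDef ∧ p.2 ∈ normalMatrices 𝕜 n Λ ∧ R * N * R⁻¹ = p.1 * p.2 * p.1⁻¹ :=
    ⟨(R, N), hR, hN, rfl⟩
  rw [rho, dif_pos h]
  exact inv_mul_mul_eq_of_posDef h.choose_spec.1 hR h.choose_spec.2.1.2 hN.2
    h.choose_spec.2.2.symm

/-- The map `ρ` in terms of a diagonalization: it inverts and conjugate-transposes the
diagonalizing matrix. -/
theorem rho_conj_diagonal {Λ : Set ℂ} (P : GL (Fin n) 𝕜) {d : Fin n → 𝕜}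
    (hd : ∀ i, embC 𝕜 (d i) ∈ Λ) :
    rho Λ ((P : Matrix (Fin n) (Fin n) 𝕜) * diagonal d *
      ((P⁻¹ : GL (Fin n) 𝕜) : Matrix (Fin n) (Fin n) 𝕜)) =
      (P : Matrix (Fin n) (Fin n) 𝕜)ᴴ⁻¹ * diagonal d * (P : Matrix (Fin n) (Fin n) 𝕜)ᴴ := by
  obtain ⟨R, N, hR, hN, h, h'⟩ := exists_posDef_normal_of_conj_diagonal P hd
  rw [h, h', rho_posDef_conj hR hN]

/-- `ρ` is the conjugate transpose of the functional calculus of complex conjugation. -/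
theorem rho_conj_diagonal_eq_aeval {Λ : Set ℂ} (P : GL (Fin n) 𝕜) {d : Fin n → 𝕜}
    (hd : ∀ i, embC 𝕜 (d i) ∈ Λ) {q : 𝕜[X]} (hq : ∀ i, q.eval (d i) = starRingEnd 𝕜 (d i)) :
    rho Λ ((P : Matrix (Fin n) (Fin n) 𝕜) * diagonal d *
      ((P⁻¹ : GL (Fin n) 𝕜) : Matrix (Fin n) (Fin n) 𝕜)) =
      (aeval ((P : Matrix (Fin n) (Fin n) 𝕜) * diagonal d *
      ((P⁻¹ : GL (Fin n) 𝕜) : Matrix (Fin n) (Fin n) 𝕜)) q)ᴴ := by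
  rw [rho_conj_diagonal P hd, aeval_units_conj, aeval_diagonal, coe_units_inv, conjTranspose_mul,
    conjTranspose_mul, conjTranspose_nonsing_inv, diagonal_conjTranspose, mul_assoc]
  congr!
  ext i
  simp [hq]

theorem rho_mem_ssMatrices {Λ : Set ℂ} (hΛ : Λ ⊆ Set.range (embC 𝕜))
    {X : Matrix (Fin n) (Fin n) 𝕜} (hX : X ∈ ssMatrices 𝕜 n Λ) :
    rho Λ X ∈ ssMatrices 𝕜 n Λ ∧ rho Λ (rho Λ X) = X := by
  obtain ⟨R, N, hR, hN, rfl⟩ := exists_posDef_normal hΛ hX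
  have h : R⁻¹⁻¹ = R := nonsing_inv_nonsing_inv _ ((isUnit_iff_isUnit_det R).1 hR.isUnit)
  have h1 := posDef_conj_mem_ssMatrices hR.inv hN
  have h2 := rho_posDef_conj hR.inv hN
  rw [h] at h1 h2
  rw [rho_posDef_conj hR hN]
  exact ⟨h1, h2⟩

/-- `ρ` commutes with complexification. -/
theorem toComplex_rho {Λ : Set ℂ} (hΛ : Λ ⊆ Set.range (embC 𝕜))
    {X : Matrix (Fin n) (Fin n) 𝕜} (hX : X ∈ ssMatrices 𝕜 n Λ) :
    toComplex (rho Λ X) = rho Λ (toComplex X) := by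
  obtain ⟨P, d, rfl, hd⟩ := exists_conj_diagonal_of_mem_ssMatrices hΛ hX
  rw [rho_conj_diagonal P hd, toComplex_conj_diagonal, rho_conj_diagonal]
  · rw [toComplex_mul, toComplex_mul, toComplex_diagonal, ← conjTranspose_nonsing_inv,
      ← coe_units_inv, toComplex_conjTranspose, toComplex_conjTranspose,
      ← conjTranspose_nonsing_inv, ← coe_units_inv]
    rfl
  · simpa only [embC_self] using hd

theorem toComplex_mem_ssMatrices {Λ : Set ℂ} {X : Matrix (Fin n) (Fin n) 𝕜} :
    toComplex X ∈ ssMatrices ℂ n Λ ↔ X ∈ ssMatrices 𝕜 n Λ := by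
  simp only [ssMatrices, arbMatrices, Set.mem_ofPred_eq, toComplex_self]

theorem toComplex_mem_arbMatrices {Λ : Set ℂ} {X : Matrix (Fin n) (Fin n) 𝕜} :
    toComplex X ∈ arbMatrices ℂ n Λ ↔ X ∈ arbMatrices 𝕜 n Λ := by
  simp only [arbMatrices, Set.mem_ofPred_eq, toComplex_self]

end Normal

/-! ### Newton interpolation -/

section Newton

open Polynomial

/-- The polynomial `∑_{k < n} a_k ∏_{i < k} (X - y_i)` in Newton form with nodes `y`. -/
noncomputable def newtonPoly (a y : ℕ → ℂ) (n : ℕ) : ℂ[X] :=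
  ∑ k ∈ Finset.range n, C (a k) * ∏ i ∈ Finset.range k, (X - C (y i))

/-- The divided difference `Δ^k f (y₀, …, y_k)` at the first members of a sequence. -/
noncomputable def divDiff (f : ℂ → ℂ) (y : ℕ → ℂ) (k : ℕ) : ℂ :=
  iterDiffQuot f k fun i => y i

theorem divDiff_succ (f : ℂ → ℂ) (y : ℕ → ℂ) (k : ℕ) :
    divDiff f y (k + 1) =
      (divDiff f (fun i => y (i + 1)) k - divDiff f y k) / (y (k + 1) - y 0) := rfl

theorem newtonPoly_succ (a y : ℕ → ℂ) (n : ℕ) : newtonPoly a y (n + 1) =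
    newtonPoly a y n + C (a n) * ∏ i ∈ Finset.range n, (X - C (y i)) :=
  Finset.sum_range_succ _ _

theorem degree_newtonPoly_lt (a y : ℕ → ℂ) (n : ℕ) : (newtonPoly a y n).degree < n := by
  induction n with
  | zero => simp [newtonPoly]
  | succ n ih =>
    rw [newtonPoly_succ]
    refine (degree_add_le _ _).trans_lt (max_lt (ih.trans (by exact_mod_cast n.lt_succ_self)) ?_)
    rw [← smul_eq_C_mul]
    refine (degree_smul_le _ _).trans_lt ?_
    rw [degree_prod]
    simp only [degree_X_sub_C, Finset.sum_const, Finset.card_range, nsmul_eq_mul, mul_one]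
    exact_mod_cast n.lt_succ_self

theorem coeff_newtonPoly_of_le (a y : ℕ → ℂ) {n k : ℕ} (h : n ≤ k) :
    (newtonPoly a y n).coeff k = 0 :=
  coeff_eq_zero_of_degree_lt ((degree_newtonPoly_lt a y n).trans_le (by exact_mod_cast h))

theorem coeff_newtonPoly_last (a y : ℕ → ℂ) (n : ℕ) : (newtonPoly a y (n + 1)).coeff n = a n := by
  have h := (monic_prod_of_monic (Finset.range n) (fun i => X - C (y i))
    fun i _ => monic_X_sub_C _).coeff_natDegree
  rw [natDegree_prod_of_monic _ _ fun i _ => monic_X_sub_C _] at h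
  simp only [natDegree_X_sub_C, Finset.sum_const, Finset.card_range, smul_eq_mul, mul_one] at h
  rw [newtonPoly_succ, coeff_add, coeff_newtonPoly_of_le a y le_rfl, coeff_C_mul, h, zero_add,
    mul_one]

/-- Newton's interpolation formula. Neville's recursion gives an interpolating polynomial with the
same leading coefficient, hence the same polynomial. -/
theorem eval_newtonPoly (f : ℂ → ℂ) (m : ℕ) (y : ℕ → ℂ)
    (hy : Set.InjOn y (Finset.range (m + 1) : Finset ℕ)) (j : ℕ) (hj : j ≤ m) :
    (newtonPoly (divDiff f y) y (m + 1)).eval (y j) = f (y j) := by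
  induction m generalizing y j with
  | zero =>
    obtain rfl : j = 0 := by omega
    simp [newtonPoly, divDiff, iterDiffQuot]
  | succ m ih =>
    set y' : ℕ → ℂ := fun i => y (i + 1) with hy'
    set p := newtonPoly (divDiff f y) y (m + 1) with hp
    set q := newtonPoly (divDiff f y') y' (m + 1) with hq
    have inj : Set.InjOn y (Finset.range (m + 1) : Finset ℕ) :=
      hy.mono (by simp)
    have inj' : Set.InjOn y' (Finset.range (m + 1) : Finset ℕ) := by
      intro i hi k hk h
      simp only [Finset.coe_range, Set.mem_Iio] at hi hk
      have := hy (by simpa using hi) (by simpa using hk) h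
      omega
    have hne : y (m + 1) - y 0 ≠ 0 := by
      intro h
      have := hy (by simp) (by simp) (sub_eq_zero.1 h)
      omega
    have evp : ∀ j ≤ m, p.eval (y j) = f (y j) := fun j hj => ih y inj j hj
    have evq : ∀ j ≤ m, q.eval (y (j + 1)) = f (y (j + 1)) := fun j hj => ih y' inj' j hj
    let r := C (y (m + 1) - y 0)⁻¹ * ((X - C (y 0)) * q - (X - C (y (m + 1))) * p)
    have evr : ∀ j ≤ m + 1, r.eval (y j) = f (y j) := by
      intro j hj
      simp only [r, eval_mul, eval_sub, eval_X, eval_C]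
      rcases Nat.eq_zero_or_pos j with rfl | h0
      · rw [evp 0 (by omega)]
        field_simp
        ring
      · obtain ⟨i, rfl⟩ := Nat.exists_eq_add_of_lt h0
        rw [zero_add] at hj ⊢
        rw [evq i (by omega)]
        rcases hj.lt_or_eq with h1 | h1
        · rw [evp (i + 1) (by omega)]
          field_simp
          ring
        · rw [h1]
          field_simp
          ring
    have hr : r = newtonPoly (divDiff f y) y (m + 1 + 1) := by
      refine Polynomial.eq_of_degree_sub_lt_of_eval_index_eq (Finset.range (m + 1)) inj ?_ ?_
      · rw [Finset.card_range, degree_lt_iff_coeff_zero]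
        intro k hk
        obtain ⟨k, rfl⟩ := Nat.exists_eq_add_of_le' (Nat.one_le_of_lt hk)
        have hk : m ≤ k := by omega
        simp only [r, sub_mul, coeff_sub, coeff_C_mul, coeff_X_mul]
        rw [coeff_newtonPoly_of_le _ _ (by omega : m + 1 ≤ k + 1),
          coeff_newtonPoly_of_le _ _ (by omega : m + 1 ≤ k + 1)]
        rcases hk.lt_or_eq with h1 | rfl
        · rw [coeff_newtonPoly_of_le _ _ (by omega), coeff_newtonPoly_of_le _ _ (by omega),
            coeff_newtonPoly_of_le _ _ (by omega)]
          ring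
        · rw [coeff_newtonPoly_last, coeff_newtonPoly_last, coeff_newtonPoly_last, divDiff_succ]
          field_simp
          ring
      · intro i hi
        have hi : i ≤ m := by simpa [Nat.lt_succ_iff] using hi
        rw [evr i (by omega), newtonPoly_succ, eval_add, ← hp, evp i hi, eval_mul, eval_prod,
          Finset.prod_eq_zero (i := i) (by simpa [Nat.lt_succ_iff] using hi) (by simp), mul_zero,
          add_zero]
    rw [← hr, evr j hj]

theorem tendsto_aeval_newtonPoly {B : Type*} [Ring B] [Algebra ℂ B] [TopologicalSpace B]
    [IsTopologicalRing B] [ContinuousSMul ℂ B] {α : Type*} {l : Filter α} {a y : α → ℕ → ℂ}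
    {a₀ y₀ : ℕ → ℂ} {n : ℕ} (ha : ∀ k < n, Tendsto (fun x => a x k) l (𝓝 (a₀ k)))
    (hy : ∀ k, Tendsto (fun x => y x k) l (𝓝 (y₀ k))) {M : α → B} {M₀ : B}
    (hM : Tendsto M l (𝓝 M₀)) :
    Tendsto (fun x => aeval (M x) (newtonPoly (a x) (y x) n)) l
      (𝓝 (aeval M₀ (newtonPoly a₀ y₀ n))) := by
  have hC : ∀ {b : α → ℂ} {b₀ : ℂ}, Tendsto b l (𝓝 b₀) →
      Tendsto (fun x => aeval (M x) (C (b x))) l (𝓝 (aeval M₀ (C b₀))) := by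
    intro b b₀ hb
    simp only [aeval_C]
    exact ((continuous_algebraMap ℂ B).tendsto _).comp hb
  have hprod : ∀ k, Tendsto (fun x => aeval (M x) (∏ i ∈ Finset.range k, (X - C (y x i)))) l
      (𝓝 (aeval M₀ (∏ i ∈ Finset.range k, (X - C (y₀ i))))) := by
    intro k
    induction k with
    | zero => simpa using tendsto_const_nhds
    | succ k ih =>
      simp only [Finset.prod_range_succ, map_mul (aeval _), map_sub, aeval_X]
      exact ih.mul (hM.sub (hC (hy k)))
  simp only [newtonPoly, map_sum, map_mul (aeval _)]
  exact tendsto_finsetSum _ fun k hk => (hC (ha k (Finset.mem_range.1 hk))).mul (hprod k)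

end Newton

/-! ### Boundedness and convergence of divided differences -/

section DividedDifferences

variable {Λ : Set ℂ} {f : ℂ → ℂ}

/-- Moving a window of length `k + 1` along a sequence of distinct points in small steps changes the
divided difference `Δ^k f` by an amount controlled by `Δ^{k+1} f`. -/
theorem norm_iterDiffQuot_window_sub_le {k : ℕ} {C δ : ℝ} {x : ℂ}
    (hC : ∀ y ∈ configSpace (k + 2) Λ, (∀ i, dist (y i) x < δ) → ‖iterDiffQuot f (k + 1) y‖ ≤ C)
    {w : ℕ → ℂ} (m : ℕ) (hw : Set.InjOn w (Set.Iio (m + k + 1))) (hwΛ : ∀ i < m + k + 1, w i ∈ Λ)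
    (hwx : ∀ i < m + k + 1, dist (w i) x < δ) :
    ‖iterDiffQuot f k (fun i => w (m + i)) - iterDiffQuot f k (fun i => w i)‖ ≤
      m * (C * (2 * δ)) := by
  induction m with
  | zero => simp
  | succ m ih =>
    have ih := ih (hw.mono (Set.Iio_subset_Iio (by omega))) (fun i hi => hwΛ i (by omega))
      (fun i hi => hwx i (by omega))
    have hne : w (m + (k + 1)) - w m ≠ 0 := by
      intro h
      have := hw (by simp; omega) (by simp; omega) (sub_eq_zero.1 h)
      omega
    have hstep : iterDiffQuot f k (fun i => w (m + 1 + i)) - iterDiffQuot f k (fun i => w (m + i)) =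
        iterDiffQuot f (k + 1) (fun i => w (m + i)) * (w (m + (k + 1)) - w m) := by
      have : iterDiffQuot f (k + 1) (fun i => w (m + i)) =
        (iterDiffQuot f k (fun i => w (m + (i + 1))) - iterDiffQuot f k (fun i => w (m + i))) /
          (w (m + (k + 1)) - w m) := rfl
      rw [this, div_mul_cancel₀ _ hne]
      simp only [add_assoc, add_comm 1]
    have hle : ‖iterDiffQuot f (k + 1) (fun i => w (m + i))‖ ≤ C := by
      refine hC _ ⟨fun i j hij => ?_, fun i => hwΛ _ (by omega)⟩ fun i => hwx _ (by omega)
      have := hw (by simp; omega) (by simp; omega) hij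
      exact Fin.ext (by omega)
    have hdist : ‖w (m + (k + 1)) - w m‖ ≤ 2 * δ := by
      rw [← dist_eq_norm]
      have h1 := dist_triangle_right (w (m + (k + 1))) (w m) x
      have h2 := hwx (m + (k + 1)) (by omega)
      have h3 := hwx m (by omega)
      linarith
    calc _ = ‖(iterDiffQuot f k (fun i => w (m + 1 + i)) - iterDiffQuot f k (fun i => w (m + i))) +
          (iterDiffQuot f k (fun i => w (m + i)) - iterDiffQuot f k (fun i => w i))‖ := by
            rw [sub_add_sub_cancel]
      _ ≤ _ := norm_add_le _ _
      _ ≤ C * (2 * δ) + m * (C * (2 * δ)) := by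
        refine add_le_add ?_ ih
        rw [hstep, norm_mul]
        exact mul_le_mul hle hdist (norm_nonneg _) ((norm_nonneg _).trans hle)
      _ = _ := by push_cast; ring

theorem norm_iterDiffQuot_sub_le_of_disjoint {k : ℕ} {C δ : ℝ} {x : ℂ}
    (hC : ∀ y ∈ configSpace (k + 2) Λ, (∀ i, dist (y i) x < δ) → ‖iterDiffQuot f (k + 1) y‖ ≤ C)
    {y z : Fin (k + 1) → ℂ} (hy : y ∈ configSpace (k + 1) Λ) (hz : z ∈ configSpace (k + 1) Λ)
    (hyx : ∀ i, dist (y i) x < δ) (hzx : ∀ i, dist (z i) x < δ) (hyz : ∀ i j, y i ≠ z j) :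
    ‖iterDiffQuot f k z - iterDiffQuot f k y‖ ≤ (k + 1 : ℕ) * (C * (2 * δ)) := by
  let w : ℕ → ℂ := fun i => if i < k + 1 then y (Fin.ofNat (k + 1) i)
    else z (Fin.ofNat (k + 1) (i - (k + 1)))
  have hwy : ∀ i : Fin (k + 1), w i = y i := fun i => by
    simp only [w, if_pos i.2, Fin.ofNat_eq_cast, Fin.cast_val_eq_self]
  have hwz : ∀ i : Fin (k + 1), w (k + 1 + i) = z i := fun i => by
    simp only [w, if_neg (show ¬ k + 1 + i.1 < k + 1 by omega), add_tsub_cancel_left,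
      Fin.ofNat_eq_cast, Fin.cast_val_eq_self]
  have hcases : ∀ i < k + 1 + k + 1, (∃ j : Fin (k + 1), i = j) ∨
      ∃ j : Fin (k + 1), i = k + 1 + j := by
    intro i hi
    by_cases h : i < k + 1
    · exact Or.inl ⟨⟨i, h⟩, rfl⟩
    · exact Or.inr ⟨⟨i - (k + 1), by omega⟩, by simp; omega⟩
  have h := norm_iterDiffQuot_window_sub_le hC (w := w) (k + 1) ?_ ?_ ?_
  · simpa only [hwy, hwz] using h
  · intro i hi j hj hij
    rcases hcases i hi with ⟨i, rfl⟩ | ⟨i, rfl⟩ <;> rcases hcases j hj with ⟨j, rfl⟩ | ⟨j, rfl⟩ <;>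
      simp only [hwy, hwz] at hij
    · rw [hy.1 hij]
    · exact absurd hij (hyz _ _)
    · exact absurd hij.symm (hyz _ _)
    · rw [hz.1 hij]
  · intro i hi
    rcases hcases i hi with ⟨i, rfl⟩ | ⟨i, rfl⟩ <;> simp only [hwy, hwz]
    · exact hy.2 i
    · exact hz.2 i
  · intro i hi
    rcases hcases i hi with ⟨i, rfl⟩ | ⟨i, rfl⟩ <;> simp only [hwy, hwz]
    · exact hyx i
    · exact hzx i

theorem exists_configSpace_avoiding {x : ℂ} (hx : AccPt x (𝓟 Λ)) (k : ℕ) {δ : ℝ} (hδ : 0 < δ)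
    {F : Set ℂ} (hF : F.Finite) :
    ∃ u ∈ configSpace k Λ, (∀ i, dist (u i) x < δ) ∧ ∀ i, u i ∉ F := by
  have h1 : ((Metric.ball x δ ∩ Λ) \ F).Infinite :=
    (Set.Infinite.of_accPt (hx.nhds_inter (Metric.ball_mem_nhds x hδ))).sdiff hF
  let e := h1.natEmbedding
  refine ⟨fun i => e i, ⟨fun i j hij => ?_, fun i => (e i).2.1.2⟩, fun i => (e i).2.1.1,
    fun i => (e i).2.2⟩
  exact Fin.ext (e.injective (Subtype.ext hij))

theorem eventually_configSpace_iff {k : ℕ} {x : ℂ} {p : (Fin k → ℂ) → Prop} :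
    (∀ᶠ y in 𝓝[configSpace k Λ] (fun _ => x), p y) ↔
      ∃ δ > 0, ∀ y ∈ configSpace k Λ, (∀ i, dist (y i) x < δ) → p y := by
  rw [eventually_nhdsWithin_iff, Metric.eventually_nhds_iff]
  refine exists_congr fun δ => and_congr_right fun hδ => ?_
  simp only [dist_pi_lt_iff hδ]
  exact forall_congr' fun y => forall_comm

/-- Boundedness of the divided differences of one order forces the convergence of those of the
preceding order: two small tuples of distinct points are compared through a third one, disjoint from
both. -/
theorem IsDC_of_IsDB_succ {k : ℕ} (h : IsDB (k + 2) f Λ) : IsDC (k + 1) f Λ := by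
  intro x hxΛ hx
  obtain ⟨C, hC⟩ := h x hxΛ hx
  change ∀ᶠ y in 𝓝[configSpace (k + 2) Λ] (fun _ => x), ‖iterDiffQuot f (k + 1) y‖ ≤ C at hC
  obtain ⟨δ₀, hδ₀, hC⟩ := eventually_configSpace_iff.1 hC
  change ∃ L : ℂ, Tendsto (iterDiffQuot f k) (𝓝[configSpace (k + 1) Λ] (fun _ => x)) (𝓝 L)
  rcases (𝓝[configSpace (k + 1) Λ] (fun _ => x)).eq_or_neBot with h0 | h0
  · exact ⟨0, h0 ▸ tendsto_bot⟩
  apply cauchy_map_iff_exists_tendsto.1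
  rw [Metric.cauchy_iff]
  refine ⟨inferInstance, fun ε hε => ?_⟩
  -- the bound `2 (k + 1) C · 2 δ` for the variation has to be below `ε`
  obtain ⟨δ, hδ, hδδ₀, hδε⟩ : ∃ δ > 0, δ ≤ δ₀ ∧
      2 * ((k + 1 : ℕ) * (C * (2 * δ))) < ε := by
    have h1 : Tendsto (fun δ : ℝ => 2 * ((k + 1 : ℕ) * (C * (2 * δ)))) (𝓝[>] 0) (𝓝 0) := by
      have : Continuous fun δ : ℝ => 2 * ((k + 1 : ℕ) * (C * (2 * δ))) := by fun_prop
      simpa using (this.tendsto 0).mono_left nhdsWithin_le_nhds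
    obtain ⟨δ, h2, h3, h4⟩ := ((h1.eventually (gt_mem_nhds hε)).and
      ((eventually_nhdsWithin_of_forall fun _ h => h).and
        (nhdsWithin_le_nhds (Iic_mem_nhds hδ₀)))).exists
    exact ⟨δ, h3, h4, h2⟩
  have hC' : ∀ y ∈ configSpace (k + 2) Λ, (∀ i, dist (y i) x < δ) →
      ‖iterDiffQuot f (k + 1) y‖ ≤ C := fun y hy hyx => hC y hy fun i => (hyx i).trans_le hδδ₀
  refine ⟨iterDiffQuot f k '' {y | y ∈ configSpace (k + 1) Λ ∧ ∀ i, dist (y i) x < δ},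
    image_mem_map ?_, ?_⟩
  · exact eventually_configSpace_iff.2 ⟨δ, hδ, fun y hy hyx => ⟨hy, hyx⟩⟩
  · rintro _ ⟨y, ⟨hy, hyx⟩, rfl⟩ _ ⟨z, ⟨hz, hzx⟩, rfl⟩
    obtain ⟨u, hu, hux, huF⟩ := exists_configSpace_avoiding hx (k + 1) hδ
      ((Set.finite_range y).union (Set.finite_range z))
    have h1 := norm_iterDiffQuot_sub_le_of_disjoint hC' hu hy hux hyx
      fun i j hij => huF i (Or.inl ⟨j, hij.symm⟩)
    have h2 := norm_iterDiffQuot_sub_le_of_disjoint hC' hu hz hux hzx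
      fun i j hij => huF i (Or.inr ⟨j, hij.symm⟩)
    rw [← dist_eq_norm] at h1 h2
    have h3 := dist_triangle_right (iterDiffQuot f k y) (iterDiffQuot f k z) (iterDiffQuot f k u)
    linarith

theorem IsDC.isDB {n : ℕ} (h : IsDC n f Λ) : IsDB n f Λ := by
  intro x hxΛ hx
  obtain ⟨L, hL⟩ := h x hxΛ hx
  refine ⟨‖L‖ + 1, ?_⟩
  exact (hL.norm.eventually (gt_mem_nhds (lt_add_one _))).mono fun y hy => hy.le

theorem IsDC.of_le {k m : ℕ} (hkm : k ≤ m) (h : IsDC (m + 1) f Λ) : IsDC (k + 1) f Λ := by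
  induction m, hkm using Nat.le_induction with
  | base => exact h
  | succ m _ ih => exact ih (IsDC_of_IsDB_succ h.isDB)

theorem IsDB.of_le {k m : ℕ} (hkm : k ≤ m) (h : IsDB (m + 1) f Λ) : IsDB (k + 1) f Λ := by
  induction m, hkm using Nat.le_induction with
  | base => exact h
  | succ m _ ih => exact ih (IsDC_of_IsDB_succ h).isDB

theorem tendsto_configSpace {α : Type*} {l : Filter α} {k : ℕ} {z : ℂ} {Y : α → ℕ → ℂ}
    (hY : ∀ i ≤ k, Tendsto (fun x => Y x i) l (𝓝 z))
    (hinj : ∀ᶠ x in l, Set.InjOn (Y x) (Set.Iic k) ∧ ∀ i ≤ k, Y x i ∈ Λ) :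
    Tendsto (fun x (i : Fin (k + 1)) => Y x i) l (𝓝[configSpace (k + 1) Λ] (fun _ => z)) := by
  refine tendsto_nhdsWithin_iff.2 ⟨tendsto_pi_nhds.2 fun i => hY i (Nat.lt_succ_iff.1 i.2), ?_⟩
  refine hinj.mono fun x hx => ⟨fun i j hij => Fin.ext ?_, fun i => hx.2 _ (Nat.lt_succ_iff.1 i.2)⟩
  exact hx.1 (Nat.lt_succ_iff.1 i.2) (Nat.lt_succ_iff.1 j.2) hij

theorem IsDC.exists_tendsto_divDiff {k : ℕ} (h : IsDC (k + 1) f Λ) {z : ℂ} (hz : z ∈ Λ)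
    (hacc : AccPt z (𝓟 Λ)) {α : Type*} {l : Filter α} {Y : α → ℕ → ℂ}
    (hY : ∀ i ≤ k, Tendsto (fun x => Y x i) l (𝓝 z))
    (hinj : ∀ᶠ x in l, Set.InjOn (Y x) (Set.Iic k) ∧ ∀ i ≤ k, Y x i ∈ Λ) :
    ∃ L, Tendsto (fun x => divDiff f (Y x) k) l (𝓝 L) := by
  obtain ⟨L, hL⟩ := h z hz hacc
  change Tendsto (iterDiffQuot f k) (𝓝[configSpace (k + 1) Λ] (fun _ => z)) (𝓝 L) at hL
  exact ⟨L, hL.comp (tendsto_configSpace hY hinj)⟩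

theorem IsDB.exists_tendsto_divDiff {k : ℕ} (h : IsDB (k + 1) f Λ) {z : ℂ} (hz : z ∈ Λ)
    (hacc : AccPt z (𝓟 Λ)) {α : Type*} {l : Ultrafilter α} {Y : α → ℕ → ℂ}
    (hY : ∀ i ≤ k, Tendsto (fun x => Y x i) l (𝓝 z))
    (hinj : ∀ᶠ x in l, Set.InjOn (Y x) (Set.Iic k) ∧ ∀ i ≤ k, Y x i ∈ Λ) :
    ∃ L, Tendsto (fun x => divDiff f (Y x) k) l (𝓝 L) := by
  obtain ⟨C, hC⟩ := h z hz hacc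
  have h2 : ∀ᶠ x in l, divDiff f (Y x) k ∈ Metric.closedBall (0 : ℂ) C :=
    ((tendsto_configSpace hY hinj).eventually hC).mono fun x hx => mem_closedBall_zero_iff.2 hx
  obtain ⟨L, -, hL⟩ := (isCompact_closedBall (0 : ℂ) C).ultrafilter_le_nhds
    (l.map fun x => divDiff f (Y x) k) (le_principal_iff.2 h2)
  exact ⟨L, hL⟩

/-- Convergence of divided differences at tuples converging to a tuple `y₀` whose equal entries are
contiguous, when it is known for constant `y₀`. Such a tuple is either constant or has distinct end
points, and then the defining recursion applies. -/
theorem exists_tendsto_divDiff_of_contiguous {α : Type*} {l : Filter α} {n : ℕ}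
    (H : ∀ k < n, ∀ z ∈ Λ, ∀ Y : α → ℕ → ℂ, (∀ i ≤ k, Tendsto (fun x => Y x i) l (𝓝 z)) →
      (∀ᶠ x in l, Set.InjOn (Y x) (Set.Iic k) ∧ ∀ i ≤ k, Y x i ∈ Λ) →
      ∃ L, Tendsto (fun x => divDiff f (Y x) k) l (𝓝 L))
    (k : ℕ) (hk : k < n) {Y : α → ℕ → ℂ} {y₀ : ℕ → ℂ}
    (hY : ∀ i ≤ k, Tendsto (fun x => Y x i) l (𝓝 (y₀ i)))
    (hinj : ∀ᶠ x in l, Set.InjOn (Y x) (Set.Iic k) ∧ ∀ i ≤ k, Y x i ∈ Λ)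
    (hy₀ : ∀ i ≤ k, y₀ i ∈ Λ)
    (hcont : ∀ i j m, i ≤ j → j ≤ m → m ≤ k → y₀ i = y₀ m → y₀ j = y₀ i) :
    ∃ L, Tendsto (fun x => divDiff f (Y x) k) l (𝓝 L) := by
  induction k generalizing Y y₀ with
  | zero =>
    refine H 0 hk _ (hy₀ 0 le_rfl) Y (fun i hi => ?_) hinj
    obtain rfl : i = 0 := by omega
    exact hY 0 le_rfl
  | succ k ih =>
    by_cases h : y₀ 0 = y₀ (k + 1)
    · refine H (k + 1) hk _ (hy₀ 0 (by omega)) Y (fun i hi => ?_) hinj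
      rw [← hcont 0 i (k + 1) (by omega) hi le_rfl h]
      exact hY i hi
    · obtain ⟨A, hA⟩ := ih (by omega) (Y := Y) (y₀ := y₀) (fun i hi => hY i (by omega))
        (hinj.mono fun x hx => ⟨hx.1.mono (Set.Iic_subset_Iic.2 (by omega)),
          fun i hi => hx.2 i (by omega)⟩) (fun i hi => hy₀ i (by omega))
        (fun i j m h1 h2 h3 => hcont i j m h1 h2 (by omega))
      obtain ⟨B, hB⟩ := ih (by omega) (Y := fun x i => Y x (i + 1)) (y₀ := fun i => y₀ (i + 1))
        (fun i hi => hY (i + 1) (by omega))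
        (hinj.mono fun x hx => ⟨fun i hi j hj hij => by
            have := hx.1 (by simp at hi ⊢; omega) (by simp at hj ⊢; omega) hij
            omega,
          fun i hi => hx.2 (i + 1) (by omega)⟩) (fun i hi => hy₀ (i + 1) (by omega))
        (fun i j m h1 h2 h3 => hcont (i + 1) (j + 1) (m + 1) (by omega) (by omega) (by omega))
      refine ⟨(B - A) / (y₀ (k + 1) - y₀ 0), ?_⟩
      simp only [divDiff_succ]
      exact (hB.sub hA).div ((hY (k + 1) le_rfl).sub (hY 0 (by omega)))
        (sub_ne_zero.2 fun h' => h h'.symm)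

end DividedDifferences

/-! ### The ordered spectrum -/

section OrderedSpectrum

open Polynomial Matrix

variable {I : Set ℝ} {γ : I → ℂ} {n : ℕ}

/-- `t` lists the parameters of the eigenvalues of `X`, with multiplicity and in non-decreasing
order. -/
def IsSpectralParam (γ : I → ℂ) (t : Fin n → I) (X : Matrix (Fin n) (Fin n) ℂ) : Prop :=
  Monotone t ∧ X.charpoly = ∏ i, (Polynomial.X - C (γ (t i)))

theorem exists_isSpectralParam_of_charpoly {X : Matrix (Fin n) (Fin n) ℂ} {u : Fin n → I}
    (h : X.charpoly = ∏ i, (Polynomial.X - C (γ (u i)))) :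
    ∃ σ : Equiv.Perm (Fin n), IsSpectralParam γ (u ∘ σ) X :=
  ⟨Tuple.sort u, Tuple.monotone_sort u, by
    rw [h]; exact (Equiv.prod_comp (Tuple.sort u) fun i => Polynomial.X - C (γ (u i))).symm⟩

theorem exists_isUpperTriangular_of_mem_arbMatrices {X : Matrix (Fin n) (Fin n) ℂ}
    (hX : X ∈ arbMatrices ℂ n (Set.range γ)) :
    ∃ (P : GL (Fin n) ℂ) (T : Matrix (Fin n) (Fin n) ℂ) (u : Fin n → I), T.IsUpperTriangular ∧
      (∀ i, T i i = γ (u i)) ∧ X = (P : Matrix (Fin n) (Fin n) ℂ) * T *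
        ((P⁻¹ : GL (Fin n) ℂ) : Matrix (Fin n) (Fin n) ℂ) ∧
      X.charpoly = ∏ i, (Polynomial.X - C (γ (u i))) := by
  obtain ⟨P, T, hT, hP⟩ := exists_conj_isUpperTriangular n X
  have h1 : X.charpoly = ∏ i, (Polynomial.X - C (T i i)) := by
    rw [hP, coe_units_inv, charpoly_units_conj, charpoly_of_isUpperTriangular T hT]
  rw [arbMatrices, Set.mem_ofPred_eq, toComplex_self, spectrum_subset_iff_of_charpoly h1] at hX
  choose u hu using hX
  refine ⟨P, T, u, hT, fun i => (hu i).symm, hP, ?_⟩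
  simp only [hu, h1]

theorem exists_isSpectralParam {X : Matrix (Fin n) (Fin n) ℂ}
    (hX : X ∈ arbMatrices ℂ n (Set.range γ)) : ∃ t : Fin n → I, IsSpectralParam γ t X := by
  obtain ⟨P, T, u, -, -, -, h⟩ := exists_isUpperTriangular_of_mem_arbMatrices hX
  obtain ⟨σ, hσ⟩ := exists_isSpectralParam_of_charpoly h
  exact ⟨_, hσ⟩

theorem mem_arbMatrices_of_isSpectralParam {X : Matrix (Fin n) (Fin n) ℂ} {t : Fin n → I}
    (h : IsSpectralParam γ t X) : X ∈ arbMatrices ℂ n (Set.range γ) := by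
  rw [arbMatrices, Set.mem_ofPred_eq, toComplex_self, spectrum_subset_iff_of_charpoly h.2]
  exact fun i => ⟨_, rfl⟩

theorem eq_of_monotone_of_map_eq (hγ : Function.Injective γ) {s t : Fin n → I} (hs : Monotone s)
    (ht : Monotone t) (h : Finset.univ.val.map (fun i => γ (s i)) =
      Finset.univ.val.map (fun i => γ (t i))) : s = t := by
  have h1 : Finset.univ.val.map s = Finset.univ.val.map t := by
    apply Multiset.map_injective hγ
    rw [Multiset.map_map, Multiset.map_map]
    exact h
  rw [Fin.univ_val_map, Fin.univ_val_map, Multiset.coe_eq_coe] at h1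
  exact List.ofFn_injective (h1.eq_of_sortedLE hs.sortedLE_ofFn ht.sortedLE_ofFn)

theorem IsSpectralParam.unique (hγ : Function.Injective γ) {X : Matrix (Fin n) (Fin n) ℂ}
    {s t : Fin n → I} (hs : IsSpectralParam γ s X) (ht : IsSpectralParam γ t X) : s = t :=
  eq_of_monotone_of_map_eq hγ hs.1 ht.1 (map_eq_of_prod_X_sub_C_eq (hs.2.symm.trans ht.2))

theorem IsSpectralParam.orderedSpectrum_eq (hγ : Function.Injective γ)
    {X : Matrix (Fin n) (Fin n) ℂ} {t : Fin n → I} (ht : IsSpectralParam γ t X) :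
    orderedSpectrum γ X = fun i => γ (t i) := by
  have hroots : X.charpoly.roots = Finset.univ.val.map (fun i => γ (t i)) := by
    rw [ht.2, ← roots_multiset_prod_X_sub_C (Finset.univ.val.map fun i => γ (t i)),
      Multiset.map_map]
    rfl
  have h : ∃ t : Fin n → I, Monotone t ∧
      X.charpoly.roots = Multiset.map (fun i => γ (t i)) Finset.univ.val := ⟨t, ht.1, hroots⟩
  rw [orderedSpectrum, dif_pos h,
    eq_of_monotone_of_map_eq hγ h.choose_spec.1 ht.1 (h.choose_spec.2.symm.trans hroots)]

theorem norm_le_of_isRoot_charpoly {X : Matrix (Fin n) (Fin n) ℂ} {z : ℂ}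
    (hz : X.charpoly.IsRoot z) : ‖z‖ ≤ ∑ i, ∑ j, ‖X i j‖ := by
  have h1 : Module.End.HasEigenvalue (Matrix.toLin' X) z := by
    rw [Module.End.hasEigenvalue_iff_mem_spectrum, Matrix.spectrum_toLin',
      mem_spectrum_iff_isRoot_charpoly]
    exact hz
  obtain ⟨k, hk⟩ := eigenvalue_mem_ball h1
  rw [mem_closedBall_iff_norm] at hk
  calc ‖z‖ ≤ ‖X k k‖ + ‖z - X k k‖ := by
        simpa using norm_add_le (X k k) (z - X k k)
    _ ≤ ‖X k k‖ + ∑ j ∈ Finset.univ.erase k, ‖X k j‖ := by gcongr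
    _ = ∑ j, ‖X k j‖ := Finset.add_sum_erase _ (fun j => ‖X k j‖) (Finset.mem_univ k)
    _ ≤ _ := Finset.single_le_sum (f := fun i => ∑ j, ‖X i j‖)
      (fun i _ => Finset.sum_nonneg fun j _ => norm_nonneg _) (Finset.mem_univ k)

theorem continuous_eval_charpoly (z : ℂ) :
    Continuous fun X : Matrix (Fin n) (Fin n) ℂ => X.charpoly.eval z := by
  simp only [eval_charpoly]
  exact (continuous_const.sub continuous_id).matrix_det

theorem eq_prod_of_tendsto {α : Type*} {l : Filter α} [l.NeBot]
    {M : α → Matrix (Fin n) (Fin n) ℂ} {M₀ : Matrix (Fin n) (Fin n) ℂ} (hM : Tendsto M l (𝓝 M₀))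
    {Y : α → Fin n → ℂ} {y : Fin n → ℂ} (hY : Tendsto Y l (𝓝 y))
    (h : ∀ᶠ x in l, (M x).charpoly = ∏ i, (Polynomial.X - C (Y x i))) :
    M₀.charpoly = ∏ i, (Polynomial.X - C (y i)) := by
  apply Polynomial.funext
  intro z
  refine tendsto_nhds_unique (((continuous_eval_charpoly z).tendsto M₀).comp hM) ?_
  have h1 : Tendsto (fun x => ∏ i, (z - Y x i)) l (𝓝 (∏ i, (z - y i))) :=
    tendsto_finsetProd _ fun i _ => tendsto_const_nhds.sub (tendsto_pi_nhds.1 hY i)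
  simp only [eval_prod, eval_sub, eval_X, eval_C]
  refine h1.congr' (h.mono fun x hx => ?_)
  simp [hx, eval_prod]

/-- The ordered parameters of the eigenvalues depend continuously on the matrix: along an ultrafilter
the eigenvalues converge by compactness, and their limits are the eigenvalues of the limit matrix,
still in the right order. -/
theorem tendsto_spectralParam (hγ : IsEmbedding γ) {α : Type*} {l : Filter α}
    {M : α → Matrix (Fin n) (Fin n) ℂ} {M₀ : Matrix (Fin n) (Fin n) ℂ} (hM : Tendsto M l (𝓝 M₀))
    {T : α → Fin n → I} {t₀ : Fin n → I} (hT : ∀ᶠ x in l, IsSpectralParam γ (T x) (M x))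
    (ht₀ : IsSpectralParam γ t₀ M₀) : Tendsto T l (𝓝 t₀) := by
  rw [tendsto_iff_ultrafilter]
  intro U hU
  have hMU := hM.mono_left hU
  have hTU : ∀ᶠ x in (U : Filter α), IsSpectralParam γ (T x) (M x) := hU hT
  have hcont : Continuous fun X : Matrix (Fin n) (Fin n) ℂ => ∑ i, ∑ j, ‖X i j‖ := by fun_prop
  have hbd : ∀ᶠ x in (U : Filter α), (fun i => γ (T x i)) ∈
      Metric.closedBall (0 : Fin n → ℂ) (∑ i, ∑ j, ‖M₀ i j‖ + 1) := by
    filter_upwards [hTU, ((hcont.tendsto M₀).comp hMU).eventually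
      (gt_mem_nhds (lt_add_one _))] with x hx hx'
    rw [mem_closedBall_zero_iff, pi_norm_le_iff_of_nonneg (by positivity)]
    intro i
    refine (norm_le_of_isRoot_charpoly ?_).trans (le_of_lt hx')
    rw [hx.2, IsRoot, eval_prod, Finset.prod_eq_zero (Finset.mem_univ i) (by simp)]
  obtain ⟨y, -, hy⟩ := (isCompact_closedBall (0 : Fin n → ℂ) _).ultrafilter_le_nhds
    (U.map fun x i => γ (T x i)) (le_principal_iff.2 hbd)
  have hy : Tendsto (fun x i => γ (T x i)) U (𝓝 y) := hy
  have hchar := eq_prod_of_tendsto hMU hy (hTU.mono fun x hx => hx.2)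
  have hyγ : ∀ i, y i ∈ Set.range γ := by
    have := mem_arbMatrices_of_isSpectralParam ht₀
    rwa [arbMatrices, Set.mem_ofPred_eq, toComplex_self,
      spectrum_subset_iff_of_charpoly hchar] at this
  choose s hs using hyγ
  have hTs : Tendsto T U (𝓝 s) := by
    rw [tendsto_pi_nhds]
    intro i
    rw [hγ.tendsto_nhds_iff, hs]
    exact tendsto_pi_nhds.1 hy i
  have hmono : Monotone s := fun i j hij =>
    le_of_tendsto_of_tendsto (tendsto_pi_nhds.1 hTs i) (tendsto_pi_nhds.1 hTs j)
      (hTU.mono fun x hx => hx.1 hij)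
  have : s = t₀ := IsSpectralParam.unique hγ.injective ⟨hmono, by simp only [hchar, hs]⟩ ht₀
  rwa [this] at hTs

theorem continuousOn_orderedSpectrum (hγ : IsEmbedding γ) :
    ContinuousOn (orderedSpectrum γ : Matrix (Fin n) (Fin n) ℂ → Fin n → ℂ)
      (arbMatrices ℂ n (Set.range γ)) := by
  intro X hX
  obtain ⟨t₀, ht₀⟩ := exists_isSpectralParam hX
  have : Nonempty (Fin n → I) := ⟨t₀⟩
  choose! T hT using fun (Y : Matrix (Fin n) (Fin n) ℂ) (hY : Y ∈ arbMatrices ℂ n (Set.range γ)) =>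
    exists_isSpectralParam hY
  have h := tendsto_spectralParam hγ (l := 𝓝[arbMatrices ℂ n (Set.range γ)] X) (M := id)
    nhdsWithin_le_nhds (T := T) (eventually_nhdsWithin_of_forall hT) ht₀
  rw [ContinuousWithinAt, ht₀.orderedSpectrum_eq hγ.injective]
  have h2 : Tendsto (fun Y i => γ (T Y i)) (𝓝[arbMatrices ℂ n (Set.range γ)] X)
      (𝓝 fun i => γ (t₀ i)) :=
    tendsto_pi_nhds.2 fun i => (hγ.continuous.tendsto _).comp (tendsto_pi_nhds.1 h i)
  refine h2.congr' (eventually_nhdsWithin_of_forall fun Y hY => ?_)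
  exact ((hT Y hY).orderedSpectrum_eq hγ.injective).symm

end OrderedSpectrum

/-! ### Matrices with simple spectrum -/

section SimpleSpectrum

open Polynomial Matrix

variable {I : Set ℝ} {γ : I → ℂ} {n : ℕ}

/-- Matrices with `n` distinct eigenvalues on the curve `γ`. -/
def simpleMatrices (γ : I → ℂ) (n : ℕ) : Set (Matrix (Fin n) (Fin n) ℂ) :=
  {X | ∃ t : Fin n → I, StrictMono t ∧ IsSpectralParam γ t X}

theorem simpleMatrices_subset_ssMatrices (hγ : Function.Injective γ) :
    simpleMatrices γ n ⊆ ssMatrices ℂ n (Set.range γ) := by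
  rintro X ⟨t, ht, h⟩
  refine ⟨mem_arbMatrices_of_isSpectralParam h, ?_⟩
  rw [toComplex_self]
  exact exists_conj_diagonal_of_charpoly (hγ.comp ht.injective) h.2

/-- Matrices with simple spectrum on the curve are dense: the diagonal of an upper triangular form is
perturbed, along the segment joining its ordered parameters to a strictly increasing tuple. -/
theorem arbMatrices_subset_closure_simpleMatrices (hI : I.OrdConnected) (hI' : I.Nontrivial)
    (hγ : Continuous γ) : arbMatrices ℂ n (Set.range γ) ⊆ closure (simpleMatrices γ n) := by
  intro X hX
  obtain ⟨P, T, u, hT, hTu, hP, hchar⟩ := exists_isUpperTriangular_of_mem_arbMatrices hX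
  obtain ⟨σ, hσ⟩ := exists_isSpectralParam_of_charpoly hchar
  obtain ⟨a, ha, b, hb, hab⟩ := hI'.exists_lt
  have hconv : Convex ℝ I := hI.convex
  let s : Fin n → ℝ := fun i => a + (i / n : ℝ) * (b - a)
  have hn : ∀ i : Fin n, (0 : ℝ) < n := fun i => by exact_mod_cast i.pos
  have hs : ∀ i, s i ∈ I := by
    intro i
    have h1 : (i / n : ℝ) ≤ 1 := by
      rw [div_le_one (hn i)]
      exact_mod_cast i.2.le
    have h0 : (0 : ℝ) ≤ i / n := by positivity
    refine hI.out ha hb ⟨?_, ?_⟩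
    · have := mul_nonneg h0 (sub_nonneg.2 hab.le)
      simp only [s]
      linarith
    · have := mul_le_mul_of_nonneg_right h1 (sub_nonneg.2 hab.le)
      simp only [s]
      linarith
  have hsm : StrictMono s := by
    intro i j hij
    have h1 : (i / n : ℝ) < j / n := by
      rw [div_lt_div_iff_of_pos_right (hn i)]
      exact_mod_cast hij
    have := mul_lt_mul_of_pos_right h1 (sub_pos.2 hab)
    simp only [s]
    linarith
  let w : Set.Icc (0 : ℝ) 1 → Fin n → I := fun ε i =>
    ⟨(1 - ε) * u (σ i) + ε * s i, hconv (u (σ i)).2 (hs i) (sub_nonneg.2 ε.2.2) ε.2.1 (by ring)⟩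
  have hw0 : w 0 = u ∘ σ := by
    ext i
    simp [w]
  have hwc : Continuous w := by
    refine continuous_pi fun i => Continuous.subtype_mk ?_ _
    fun_prop
  have hwm : ∀ ε : Set.Icc (0 : ℝ) 1, 0 < ε → StrictMono (w ε) := by
    intro ε hε i j hij
    have h1 : (u (σ i) : ℝ) ≤ u (σ j) := hσ.1 hij.le
    have h2 := mul_le_mul_of_nonneg_left h1 (sub_nonneg.2 ε.2.2)
    have h3 := mul_lt_mul_of_pos_left (hsm hij) (show (0 : ℝ) < ε from hε)
    exact Subtype.mk_lt_mk.2 (add_lt_add_of_le_of_lt h2 h3)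
  let D : Set.Icc (0 : ℝ) 1 → Matrix (Fin n) (Fin n) ℂ := fun ε =>
    (P : Matrix (Fin n) (Fin n) ℂ) *
      (T + diagonal fun i => γ (w ε (σ.symm i)) - γ (u i)) *
      ((P⁻¹ : GL (Fin n) ℂ) : Matrix (Fin n) (Fin n) ℂ)
  have hD0 : D 0 = X := by
    simp only [D, hw0, hP]
    simp
  have hDc : Continuous D := by
    have h1 : Continuous fun ε => diagonal fun i => γ (w ε (σ.symm i)) - γ (u i) :=
      Continuous.matrix_diagonal (continuous_pi fun i =>
        (hγ.comp ((continuous_apply (σ.symm i)).comp hwc)).sub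
          (continuous_const (y := γ (u i))))
    exact (continuous_const.mul (continuous_const.add h1)).mul continuous_const
  have hDs : ∀ ε : Set.Icc (0 : ℝ) 1, 0 < ε → D ε ∈ simpleMatrices γ n := by
    intro ε hε
    refine ⟨w ε, hwm ε hε, (hwm ε hε).monotone, ?_⟩
    have h1 : (T + diagonal fun i => γ (w ε (σ.symm i)) - γ (u i)).IsUpperTriangular :=
      hT.add (blockTriangular_diagonal _)
    simp only [D]
    rw [coe_units_inv, charpoly_units_conj, charpoly_of_isUpperTriangular _ h1]
    simp only [Matrix.add_apply, hTu, diagonal_apply_eq, add_sub_cancel]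
    exact Equiv.prod_comp σ.symm fun i => Polynomial.X - C (γ (w ε i))
  rw [← hD0]
  have hne : (𝓝[>] (0 : Set.Icc (0 : ℝ) 1)).NeBot :=
    nhdsGT_neBot_of_exists_gt ⟨1, zero_lt_one⟩
  have h1 : Tendsto D (𝓝[>] 0) (𝓝 (D 0)) := (hDc.tendsto 0).mono_left nhdsWithin_le_nhds
  have h2 : ∀ᶠ ε in 𝓝[>] (0 : Set.Icc (0 : ℝ) 1), D ε ∈ simpleMatrices γ n :=
    eventually_nhdsWithin_of_forall hDs
  exact mem_closure_of_tendsto h1 h2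

end SimpleSpectrum

/-! ### Continuity of `ρ` from conditions on divided differences -/

section ContinuityRho

open Polynomial Matrix

/-- For a matrix with distinct eigenvalues `y₀, …, y_m`, the map `ρ` is given by Newton's
interpolation formula for complex conjugation. -/
theorem rho_eq_aeval_newtonPoly {m : ℕ} {Λ : Set ℂ} {X : Matrix (Fin (m + 1)) (Fin (m + 1)) ℂ}
    {y : ℕ → ℂ} (hy : Set.InjOn y (Finset.range (m + 1) : Finset ℕ)) (hyΛ : ∀ i ≤ m, y i ∈ Λ)
    (hX : X.charpoly = ∏ i : Fin (m + 1), (Polynomial.X - C (y i))) :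
    X ∈ ssMatrices ℂ (m + 1) Λ ∧
      rho Λ X = (aeval X (newtonPoly (divDiff (starRingEnd ℂ) y) y (m + 1)))ᴴ := by
  have hinj : Function.Injective fun i : Fin (m + 1) => y i := fun i j hij =>
    Fin.ext (hy (by simp; omega) (by simp; omega) hij)
  obtain ⟨P, d, hP⟩ := exists_conj_diagonal_of_charpoly hinj hX
  have hd : ∀ i, ∃ j ≤ m, y j = d i := by
    intro i
    have h1 : X.charpoly.IsRoot (d i) := by
      rw [hP, charpoly_conj_diagonal, IsRoot, eval_prod,
        Finset.prod_eq_zero (Finset.mem_univ i) (by simp)]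
    rw [hX, IsRoot, eval_prod, Finset.prod_eq_zero_iff] at h1
    obtain ⟨j, -, hj⟩ := h1
    rw [eval_sub, eval_X, eval_C, sub_eq_zero] at hj
    exact ⟨j, Nat.lt_succ_iff.1 j.2, hj.symm⟩
  have hdΛ : ∀ i, embC ℂ (d i) ∈ Λ := by
    intro i
    obtain ⟨j, hj, h⟩ := hd i
    rw [embC_self, ← h]
    exact hyΛ j hj
  rw [hP]
  refine ⟨conj_diagonal_mem_ssMatrices P hdΛ, rho_conj_diagonal_eq_aeval P hdΛ fun i => ?_⟩
  obtain ⟨j, hj, h⟩ := hd i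
  rw [← h]
  exact eval_newtonPoly _ m y hy j hj

variable {I : Set ℝ} {γ : I → ℂ}

theorem charpoly_rho {n : ℕ} {Λ : Set ℂ} {X : Matrix (Fin n) (Fin n) ℂ}
    (hX : X ∈ ssMatrices ℂ n Λ) : (rho Λ X).charpoly = X.charpoly := by
  obtain ⟨P, d, rfl, hd⟩ := exists_conj_diagonal_of_mem_ssMatrices
    (by rintro z -; exact ⟨z, embC_self z⟩) hX
  have h1 := charpoly_units_conj (star P⁻¹ : GL (Fin n) ℂ) (diagonal d)
  have h2 : ((star P⁻¹ : GL (Fin n) ℂ) : Matrix (Fin n) (Fin n) ℂ) =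
      (P : Matrix (Fin n) (Fin n) ℂ)ᴴ⁻¹ := by
    rw [← conjTranspose_nonsing_inv, ← coe_units_inv]
    rfl
  rw [h2, nonsing_inv_nonsing_inv] at h1
  · rw [rho_conj_diagonal P hd, h1, charpoly_conj_diagonal, charpoly_diagonal]
  · exact (isUnit_iff_isUnit_det _).1 P.isUnit.star

/-- If the divided differences of complex conjugation converge along a filter of matrices with simple
spectrum tending to `X₀`, then `ρ` converges along it, to the conjugate transpose of a polynomial in
`X₀` interpolating complex conjugation at the eigenvalues of `X₀`. -/
theorem exists_tendsto_rho {m : ℕ} (hγ : IsEmbedding γ)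
    {X₀ : Matrix (Fin (m + 1)) (Fin (m + 1)) ℂ} {t₀ : Fin (m + 1) → I}
    (ht₀ : IsSpectralParam γ t₀ X₀) {l : Filter (Matrix (Fin (m + 1)) (Fin (m + 1)) ℂ)} [l.NeBot]
    (hl : l ≤ 𝓝[simpleMatrices γ (m + 1)] X₀)
    (H : ∀ k < m + 1, ∀ z ∈ Set.range γ, ∀ Y : Matrix (Fin (m + 1)) (Fin (m + 1)) ℂ → ℕ → ℂ,
      (∀ i ≤ k, Tendsto (fun x => Y x i) l (𝓝 z)) →
      (∀ᶠ x in l, Set.InjOn (Y x) (Set.Iic k) ∧ ∀ i ≤ k, Y x i ∈ Set.range γ) →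
      ∃ L, Tendsto (fun x => divDiff (starRingEnd ℂ) (Y x) k) l (𝓝 L)) :
    ∃ q : ℂ[X], (∀ i, q.eval (γ (t₀ i)) = starRingEnd ℂ (γ (t₀ i))) ∧
      Tendsto (rho (Set.range γ)) l (𝓝 (aeval X₀ q)ᴴ) := by
  have : Nonempty (Fin (m + 1) → I) := ⟨t₀⟩
  choose! T hTs hT using fun (X : Matrix (Fin (m + 1)) (Fin (m + 1)) ℂ)
    (hX : X ∈ simpleMatrices γ (m + 1)) => hX
  have hls : ∀ᶠ X in l, X ∈ simpleMatrices γ (m + 1) := hl self_mem_nhdsWithin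
  have hlX : Tendsto id l (𝓝 X₀) := hl.trans nhdsWithin_le_nhds
  have hTt := tendsto_spectralParam hγ hlX (hls.mono hT) ht₀
  let Y : Matrix (Fin (m + 1)) (Fin (m + 1)) ℂ → ℕ → ℂ := fun X k => γ (T X (Fin.ofNat (m + 1) k))
  let y₀ : ℕ → ℂ := fun k => γ (t₀ (Fin.ofNat (m + 1) k))
  have hYt : ∀ k, Tendsto (fun X => Y X k) l (𝓝 (y₀ k)) := fun k =>
    (hγ.continuous.tendsto _).comp (tendsto_pi_nhds.1 hTt _)
  have hval : ∀ k < m + 1, (Fin.ofNat (m + 1) k : Fin (m + 1)).1 = k := fun k hk =>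
    Nat.mod_eq_of_lt hk
  have hYinj : ∀ X ∈ simpleMatrices γ (m + 1), Set.InjOn (Y X) (Set.Iic m) := by
    intro X hX i hi j hj hij
    have h1 := congrArg Fin.val ((hTs X hX).injective (hγ.injective hij))
    rwa [hval i (Nat.lt_succ_iff.2 hi), hval j (Nat.lt_succ_iff.2 hj)] at h1
  have hcont : ∀ i j k, i ≤ j → j ≤ k → k ≤ m → y₀ i = y₀ k → y₀ j = y₀ i := by
    intro i j k hij hjk hkm h
    have h1 : (Fin.ofNat (m + 1) i : Fin (m + 1)) ≤ Fin.ofNat (m + 1) j := by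
      rw [Fin.le_def, hval i (by omega), hval j (by omega)]
      exact hij
    have h2 : (Fin.ofNat (m + 1) j : Fin (m + 1)) ≤ Fin.ofNat (m + 1) k := by
      rw [Fin.le_def, hval j (by omega), hval k (by omega)]
      exact hjk
    have h3 := hγ.injective h
    exact congrArg γ (le_antisymm ((ht₀.1 h2).trans h3.ge) (ht₀.1 h1))
  have hlim : ∀ k, ∃ L, k < m + 1 →
      Tendsto (fun X => divDiff (starRingEnd ℂ) (Y X) k) l (𝓝 L) := by
    intro k
    by_cases hk : k < m + 1
    · obtain ⟨L, hL⟩ := exists_tendsto_divDiff_of_contiguous H k hk (Y := Y) (y₀ := y₀)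
        (fun i _ => hYt i) (hls.mono fun X hX =>
          ⟨(hYinj X hX).mono (Set.Iic_subset_Iic.2 (by omega)), fun i _ => ⟨_, rfl⟩⟩)
        (fun i _ => ⟨_, rfl⟩) (fun i j p h1 h2 h3 => hcont i j p h1 h2 (by omega))
      exact ⟨L, fun _ => hL⟩
    · exact ⟨0, fun h => absurd h hk⟩
  choose a₀ ha₀ using hlim
  have hrange : ((Finset.range (m + 1) : Finset ℕ) : Set ℕ) = Set.Iic m := by
    ext i
    simp
  refine ⟨newtonPoly a₀ y₀ (m + 1), fun i => ?_, ?_⟩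
  · have h1 := tendsto_aeval_newtonPoly (n := m + 1) ha₀ hYt (hYt i)
    have h2 : Tendsto (fun X => starRingEnd ℂ (Y X i)) l (𝓝 (starRingEnd ℂ (y₀ i))) :=
      (Complex.continuous_conj.tendsto _).comp (hYt i)
    have h3 : y₀ i = γ (t₀ i) := by
      simp only [y₀, Fin.ofNat_eq_cast, Fin.cast_val_eq_self]
    rw [← h3]
    refine tendsto_nhds_unique h1 (h2.congr' (hls.mono fun X hX => ?_))
    simp only [coe_aeval_eq_eval]
    exact (eval_newtonPoly _ m (Y X) (hrange ▸ hYinj X hX) i (Nat.lt_succ_iff.1 i.2)).symm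
  · have h1 := tendsto_aeval_newtonPoly (n := m + 1) ha₀ hYt hlX
    refine ((continuous_id.matrix_conjTranspose.tendsto _).comp h1).congr' (hls.mono fun X hX => ?_)
    refine ((rho_eq_aeval_newtonPoly (Λ := Set.range γ) (y := Y X) (hrange ▸ hYinj X hX)
      (fun i _ => ⟨_, rfl⟩) ?_).2).symm
    rw [id, (hT X hX).2]
    simp only [Y, Fin.ofNat_eq_cast, Fin.cast_val_eq_self]

theorem tendsto_rho_of_isDB {m : ℕ} (hγ : IsEmbedding γ)
    (hacc : ∀ z ∈ Set.range γ, AccPt z (𝓟 (Set.range γ)))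
    (hDB : IsDB (m + 1) (starRingEnd ℂ) (Set.range γ))
    {X₀ : Matrix (Fin (m + 1)) (Fin (m + 1)) ℂ} (hX₀ : X₀ ∈ ssMatrices ℂ (m + 1) (Set.range γ)) :
    Tendsto (rho (Set.range γ)) (𝓝[simpleMatrices γ (m + 1)] X₀)
      (𝓝 (rho (Set.range γ) X₀)) := by
  rw [tendsto_iff_ultrafilter]
  intro U hU
  obtain ⟨t₀, ht₀⟩ := exists_isSpectralParam hX₀.1
  obtain ⟨q, hq, hlim⟩ := exists_tendsto_rho hγ ht₀ hU fun k hk z hz Y hY hYΛ =>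
    IsDB.exists_tendsto_divDiff (hDB.of_le (Nat.lt_succ_iff.1 hk)) hz (hacc z hz) hY hYΛ
  obtain ⟨P, d, rfl, hd⟩ := exists_conj_diagonal_of_mem_ssMatrices
    (by rintro z -; exact ⟨z, embC_self z⟩) hX₀
  rwa [rho_conj_diagonal_eq_aeval P hd (q := q)]
  intro i
  have h1 : (∏ j, (Polynomial.X - C (γ (t₀ j)))).IsRoot (d i) := by
    rw [← ht₀.2, charpoly_conj_diagonal, IsRoot, eval_prod,
      Finset.prod_eq_zero (Finset.mem_univ i) (by simp)]
  rw [IsRoot, eval_prod, Finset.prod_eq_zero_iff] at h1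
  obtain ⟨j, -, hj⟩ := h1
  rw [eval_sub, eval_X, eval_C, sub_eq_zero] at hj
  rw [hj, hq]

theorem continuousOn_rho_of_isDB {m : ℕ} (hI : I.OrdConnected) (hI' : I.Nontrivial)
    (hγ : IsEmbedding γ) (hacc : ∀ z ∈ Set.range γ, AccPt z (𝓟 (Set.range γ)))
    (hDB : IsDB (m + 1) (starRingEnd ℂ) (Set.range γ)) :
    ContinuousOn (rho (Set.range γ) : Matrix (Fin (m + 1)) (Fin (m + 1)) ℂ → _)
      (ssMatrices ℂ (m + 1) (Set.range γ)) := by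
  have hcl : ssMatrices ℂ (m + 1) (Set.range γ) ⊆ closure (simpleMatrices γ (m + 1)) :=
    fun X hX => arbMatrices_subset_closure_simpleMatrices hI hI' hγ.continuous hX.1
  refine (continuousOn_extendFrom hcl fun X hX =>
    ⟨_, tendsto_rho_of_isDB hγ hacc hDB hX⟩).congr fun X hX => ?_
  exact (extendFrom_eq (hcl hX) (tendsto_rho_of_isDB hγ hacc hDB hX)).symm

theorem exists_extension_rho_of_isDC {m : ℕ} (hI : I.OrdConnected) (hI' : I.Nontrivial)
    (hγ : IsEmbedding γ) (hacc : ∀ z ∈ Set.range γ, AccPt z (𝓟 (Set.range γ)))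
    (hDC : IsDC (m + 1) (starRingEnd ℂ) (Set.range γ)) :
    ∃ ψ : Matrix (Fin (m + 1)) (Fin (m + 1)) ℂ → Matrix (Fin (m + 1)) (Fin (m + 1)) ℂ,
      ContinuousOn ψ (arbMatrices ℂ (m + 1) (Set.range γ)) ∧
      Set.EqOn ψ (rho (Set.range γ)) (ssMatrices ℂ (m + 1) (Set.range γ)) ∧
      Set.MapsTo ψ (arbMatrices ℂ (m + 1) (Set.range γ))
        (arbMatrices ℂ (m + 1) (Set.range γ)) := by
  have hcl := arbMatrices_subset_closure_simpleMatrices (n := m + 1) hI hI' hγ.continuous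
  have hlim : ∀ X ∈ arbMatrices ℂ (m + 1) (Set.range γ),
      ∃ Z, Tendsto (rho (Set.range γ)) (𝓝[simpleMatrices γ (m + 1)] X) (𝓝 Z) := by
    intro X hX
    have := mem_closure_iff_nhdsWithin_neBot.1 (hcl hX)
    obtain ⟨t₀, ht₀⟩ := exists_isSpectralParam hX
    obtain ⟨q, -, hlim⟩ := exists_tendsto_rho hγ ht₀ le_rfl fun k hk z hz Y hY hYΛ =>
      IsDC.exists_tendsto_divDiff (hDC.of_le (Nat.lt_succ_iff.1 hk)) hz (hacc z hz) hY hYΛ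
    exact ⟨_, hlim⟩
  refine ⟨extendFrom (simpleMatrices γ (m + 1)) (rho (Set.range γ)),
    continuousOn_extendFrom hcl hlim,
    fun X hX => extendFrom_eq (hcl hX.1) (tendsto_rho_of_isDB hγ hacc hDC.isDB hX),
    fun X hX => ?_⟩
  -- the characteristic polynomial is preserved in the limit
  have := mem_closure_iff_nhdsWithin_neBot.1 (hcl hX)
  have hch : (extendFrom (simpleMatrices γ (m + 1)) (rho (Set.range γ)) X).charpoly =
      X.charpoly := by
    apply Polynomial.funext
    intro z
    have h1 := ((continuous_eval_charpoly z).tendsto _).comp (tendsto_extendFrom (hlim X hX))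
    have h2 : Tendsto (fun Y => Y.charpoly.eval z) (𝓝[simpleMatrices γ (m + 1)] X)
        (𝓝 (X.charpoly.eval z)) :=
      ((continuous_eval_charpoly z).tendsto X).mono_left nhdsWithin_le_nhds
    refine tendsto_nhds_unique h1 (h2.congr' (eventually_nhdsWithin_of_forall fun Y hY => ?_))
    rw [Function.comp_apply, charpoly_rho (simpleMatrices_subset_ssMatrices hγ.injective hY)]
  rw [arbMatrices, Set.mem_ofPred_eq, toComplex_self, spectrum_eq_of_charpoly_eq hch]
  rwa [arbMatrices, Set.mem_ofPred_eq, toComplex_self] at hX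

end ContinuityRho

/-! ### Basic maps and compositions -/

section Compositions

open Polynomial Matrix

variable {𝕜 : Type*} [RCLike 𝕜] {I : Set ℝ} {γ : I → ℂ} {n : ℕ}

theorem mem_arbMatrices_of_charpoly_eq {Λ : Set ℂ} {X Y : Matrix (Fin n) (Fin n) ℂ}
    (hX : X ∈ arbMatrices ℂ n Λ) (h : Y.charpoly = X.charpoly) : Y ∈ arbMatrices ℂ n Λ := by
  rw [arbMatrices, Set.mem_ofPred_eq, toComplex_self] at hX ⊢
  rwa [spectrum_eq_of_charpoly_eq h]

theorem charpoly_Ad (T : GL (Fin n) ℂ) (X : Matrix (Fin n) (Fin n) ℂ) :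
    (Ad T X).charpoly = X.charpoly := by
  rw [Ad, coe_units_inv, charpoly_units_conj]

theorem continuous_Ad (T : GL (Fin n) ℂ) : Continuous (Ad T) :=
  (continuous_const.mul continuous_id).mul continuous_const

theorem Ad_mul (T : GL (Fin n) ℂ) (X Y : Matrix (Fin n) (Fin n) ℂ) :
    Ad T (X * Y) = Ad T X * Ad T Y := by
  simp only [Ad, mul_assoc, Units.inv_mul_cancel_left]

theorem commute_Ad {T : GL (Fin n) ℂ} {X Y : Matrix (Fin n) (Fin n) ℂ} (h : Commute X Y) :
    Commute (Ad T X) (Ad T Y) := by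
  rw [Commute, SemiconjBy, ← Ad_mul, ← Ad_mul, h.eq]

theorem transpose_mem_ssMatrices {Λ : Set ℂ} {X : Matrix (Fin n) (Fin n) ℂ}
    (hX : X ∈ ssMatrices ℂ n Λ) : Xᵀ ∈ ssMatrices ℂ n Λ := by
  refine ⟨mem_arbMatrices_of_charpoly_eq hX.1 (charpoly_transpose X), ?_⟩
  obtain ⟨-, P, d, hP⟩ := hX
  rw [toComplex_self] at hP ⊢
  refine ⟨⟨(P⁻¹ : GL (Fin n) ℂ).1ᵀ, P.1ᵀ, ?_, ?_⟩, d, ?_⟩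
  · rw [← transpose_mul, ← Units.val_mul, mul_inv_cancel, Units.val_one, transpose_one]
  · rw [← transpose_mul, ← Units.val_mul, inv_mul_cancel, Units.val_one, transpose_one]
  · rw [hP, transpose_mul, transpose_mul, diagonal_transpose, ← mul_assoc]
    rfl

theorem diagonal_orderedSpectrum_mem (hγ : Function.Injective γ) {X : Matrix (Fin n) (Fin n) ℂ}
    (hX : X ∈ arbMatrices ℂ n (Set.range γ)) :
    diagonal (orderedSpectrum γ X) ∈ ssMatrices ℂ n (Set.range γ) ∧
      (diagonal (orderedSpectrum γ X)).charpoly = X.charpoly := by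
  obtain ⟨t, ht⟩ := exists_isSpectralParam hX
  have h1 : (diagonal (orderedSpectrum γ X)).charpoly = X.charpoly := by
    rw [charpoly_diagonal, ht.orderedSpectrum_eq hγ, ht.2]
  refine ⟨⟨mem_arbMatrices_of_charpoly_eq hX h1, 1, orderedSpectrum γ X, ?_⟩, h1⟩
  rw [toComplex_self]
  simp

variable {β : Matrix (Fin n) (Fin n) ℂ → Matrix (Fin n) (Fin n) ℂ}

theorem subset_range_embC_complex (Λ : Set ℂ) : Λ ⊆ Set.range (embC ℂ) :=
  fun z _ => ⟨z, embC_self z⟩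

theorem IsBasic.mem_ssMatrices (hγ : Function.Injective γ) (hβ : IsBasic γ β)
    {X : Matrix (Fin n) (Fin n) ℂ} (hX : X ∈ ssMatrices ℂ n (Set.range γ)) :
    β X ∈ ssMatrices ℂ n (Set.range γ) ∧ (β X).charpoly = X.charpoly := by
  cases hβ with
  | conj T =>
    simp only [toComplex_self]
    exact ⟨conj_mem_ssMatrices hX T, charpoly_Ad T X⟩
  | transposeConj T =>
    simp only [toComplex_self]
    exact ⟨conj_mem_ssMatrices (transpose_mem_ssMatrices hX) T,
      (charpoly_Ad T _).trans (charpoly_transpose X)⟩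
  | spec T =>
    simp only [toComplex_self]
    have h := diagonal_orderedSpectrum_mem hγ hX.1
    exact ⟨conj_mem_ssMatrices h.1 T, (charpoly_Ad T _).trans h.2⟩
  | rho =>
    simp only [toComplex_self]
    exact ⟨(rho_mem_ssMatrices (subset_range_embC_complex _) hX).1, charpoly_rho hX⟩

/-- On semisimple matrices, `ρ` is the conjugate transpose of a polynomial. -/
theorem exists_rho_eq_aeval {Λ : Set ℂ} {X : Matrix (Fin n) (Fin n) ℂ}
    (hX : X ∈ ssMatrices ℂ n Λ) : ∃ q : ℂ[X], rho Λ X = (aeval X q)ᴴ := by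
  classical
  obtain ⟨P, d, rfl, hd⟩ := exists_conj_diagonal_of_mem_ssMatrices (subset_range_embC_complex _) hX
  refine ⟨Lagrange.interpolate (Finset.univ.image d) id (starRingEnd ℂ),
    rho_conj_diagonal_eq_aeval P hd fun i => ?_⟩
  exact Lagrange.eval_interpolate_at_node _ (Set.injOn_id _)
    (Finset.mem_image_of_mem d (Finset.mem_univ i))

theorem IsBasic.commute (hβ : IsBasic γ β) {X Y : Matrix (Fin n) (Fin n) ℂ}
    (hX : X ∈ ssMatrices ℂ n (Set.range γ)) (hY : Y ∈ ssMatrices ℂ n (Set.range γ))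
    (h : Commute X Y) : Commute (β X) (β Y) := by
  cases hβ with
  | conj T =>
    simp only [toComplex_self]
    exact commute_Ad h
  | transposeConj T =>
    simp only [toComplex_self]
    refine commute_Ad ?_
    rw [Commute, SemiconjBy, ← transpose_mul, ← transpose_mul, h.eq]
  | spec T =>
    refine commute_Ad ?_
    rw [Commute, SemiconjBy, diagonal_mul_diagonal, diagonal_mul_diagonal]
    simp only [mul_comm]
  | rho =>
    simp only [toComplex_self]
    obtain ⟨p, hp⟩ := exists_rho_eq_aeval hX
    obtain ⟨q, hq⟩ := exists_rho_eq_aeval hY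
    rw [hp, hq]
    exact commute_conjTranspose
      (commute_aeval_of_commute (commute_aeval_of_commute h.symm q).symm p)

theorem IsBasic.continuousOn {m : ℕ}
    {β : Matrix (Fin (m + 1)) (Fin (m + 1)) ℂ → Matrix (Fin (m + 1)) (Fin (m + 1)) ℂ}
    (hI : I.OrdConnected) (hI' : I.Nontrivial)
    (hγ : IsEmbedding γ) (hacc : ∀ z ∈ Set.range γ, AccPt z (𝓟 (Set.range γ)))
    (hDB : IsDB (m + 1) (starRingEnd ℂ) (Set.range γ)) (hβ : IsBasic γ β) :
    ContinuousOn β (ssMatrices ℂ (m + 1) (Set.range γ)) := by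
  cases hβ with
  | conj T =>
    simp only [toComplex_self]
    exact (continuous_Ad T).continuousOn
  | transposeConj T =>
    simp only [toComplex_self]
    exact ((continuous_Ad T).comp continuous_id.matrix_transpose).continuousOn
  | spec T =>
    simp only [toComplex_self]
    have h1 : ContinuousOn (orderedSpectrum γ) (ssMatrices ℂ (m + 1) (Set.range γ)) :=
      (continuousOn_orderedSpectrum hγ).mono fun X hX => hX.1
    exact (((continuous_Ad T).comp continuous_id.matrix_diagonal).comp_continuousOn h1)
  | rho =>
    simp only [toComplex_self]
    exact continuousOn_rho_of_isDB hI hI' hγ hacc hDB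

theorem IsBasic.exists_extension {m : ℕ}
    {β : Matrix (Fin (m + 1)) (Fin (m + 1)) ℂ → Matrix (Fin (m + 1)) (Fin (m + 1)) ℂ}
    (hI : I.OrdConnected) (hI' : I.Nontrivial)
    (hγ : IsEmbedding γ) (hacc : ∀ z ∈ Set.range γ, AccPt z (𝓟 (Set.range γ)))
    (hDC : IsDC (m + 1) (starRingEnd ℂ) (Set.range γ)) (hβ : IsBasic γ β) :
    ∃ ψ : Matrix (Fin (m + 1)) (Fin (m + 1)) ℂ → Matrix (Fin (m + 1)) (Fin (m + 1)) ℂ,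
      ContinuousOn ψ (arbMatrices ℂ (m + 1) (Set.range γ)) ∧
      Set.EqOn ψ β (ssMatrices ℂ (m + 1) (Set.range γ)) ∧
      Set.MapsTo ψ (arbMatrices ℂ (m + 1) (Set.range γ))
        (arbMatrices ℂ (m + 1) (Set.range γ)) := by
  cases hβ with
  | conj T =>
    refine ⟨_, ?_, fun _ _ => rfl, fun X hX => ?_⟩
    · simp only [toComplex_self]
      exact (continuous_Ad T).continuousOn
    · rw [toComplex_self]
      exact mem_arbMatrices_of_charpoly_eq hX (charpoly_Ad T X)
  | transposeConj T =>
    refine ⟨_, ?_, fun _ _ => rfl, fun X hX => ?_⟩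
    · simp only [toComplex_self]
      exact ((continuous_Ad T).comp continuous_id.matrix_transpose).continuousOn
    · rw [toComplex_self]
      exact mem_arbMatrices_of_charpoly_eq hX ((charpoly_Ad T _).trans (charpoly_transpose X))
  | spec T =>
    refine ⟨_, ?_, fun _ _ => rfl, fun X hX => ?_⟩
    · simp only [toComplex_self]
      exact (((continuous_Ad T).comp continuous_id.matrix_diagonal).comp_continuousOn
        (continuousOn_orderedSpectrum hγ))
    · rw [toComplex_self]
      exact mem_arbMatrices_of_charpoly_eq hX ((charpoly_Ad T _).trans
        (diagonal_orderedSpectrum_mem hγ.injective hX).2)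
  | rho =>
    simp only [toComplex_self]
    exact exists_extension_rho_of_isDC hI hI' hγ hacc hDC

/-- Every basic map over `𝕜` is the complexification followed by a basic map over `ℂ`. -/
theorem IsBasic.exists_eqOn_comp_toComplex (hΛ : Set.range γ ⊆ Set.range (embC 𝕜))
    {φ : Matrix (Fin n) (Fin n) 𝕜 → Matrix (Fin n) (Fin n) ℂ} (hφ : IsBasic γ φ) :
    ∃ β : Matrix (Fin n) (Fin n) ℂ → Matrix (Fin n) (Fin n) ℂ, IsBasic γ β ∧
      Set.EqOn φ (fun X => β (toComplex X)) (ssMatrices 𝕜 n (Set.range γ)) := by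
  cases hφ with
  | conj T => exact ⟨_, .conj T, fun X _ => by simp only [toComplex_self]⟩
  | transposeConj T => exact ⟨_, .transposeConj T, fun X _ => by simp only [toComplex_self]⟩
  | spec T => exact ⟨_, .spec T, fun X _ => by simp only [toComplex_self]⟩
  | rho => exact ⟨_, .rho, fun X hX => by simp only [toComplex_self, toComplex_rho hΛ hX]⟩

variable {φ : Matrix (Fin n) (Fin n) 𝕜 → Matrix (Fin n) (Fin n) ℂ}

theorem IsComposition.mem_ssMatrices (hΛ : Set.range γ ⊆ Set.range (embC 𝕜))
    (hγ : Function.Injective γ) (hφ : IsComposition γ φ)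
    {X : Matrix (Fin n) (Fin n) 𝕜} (hX : X ∈ ssMatrices 𝕜 n (Set.range γ)) :
    φ X ∈ ssMatrices ℂ n (Set.range γ) ∧ (φ X).charpoly = (toComplex X).charpoly := by
  induction hφ with
  | basic h =>
    obtain ⟨β, hβ, he⟩ := h.exists_eqOn_comp_toComplex hΛ
    rw [he hX]
    exact hβ.mem_ssMatrices hγ (toComplex_mem_ssMatrices.2 hX)
  | comp _ hψ ih =>
    have h := hψ.mem_ssMatrices hγ ih.1
    exact ⟨h.1, h.2.trans ih.2⟩

theorem IsComposition.commute (hΛ : Set.range γ ⊆ Set.range (embC 𝕜))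
    (hγ : Function.Injective γ) (hφ : IsComposition γ φ) {X Y : Matrix (Fin n) (Fin n) 𝕜}
    (hX : X ∈ ssMatrices 𝕜 n (Set.range γ)) (hY : Y ∈ ssMatrices 𝕜 n (Set.range γ))
    (h : Commute X Y) : Commute (φ X) (φ Y) := by
  induction hφ with
  | basic h' =>
    obtain ⟨β, hβ, he⟩ := h'.exists_eqOn_comp_toComplex hΛ
    rw [he hX, he hY]
    refine hβ.commute (toComplex_mem_ssMatrices.2 hX) (toComplex_mem_ssMatrices.2 hY) ?_
    rw [Commute, SemiconjBy, ← toComplex_mul, ← toComplex_mul, h.eq]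
  | comp hφ hψ ih =>
    exact hψ.commute (hφ.mem_ssMatrices hΛ hγ hX).1 (hφ.mem_ssMatrices hΛ hγ hY).1 ih

theorem IsComposition.continuousOn {m : ℕ}
    {φ : Matrix (Fin (m + 1)) (Fin (m + 1)) 𝕜 → Matrix (Fin (m + 1)) (Fin (m + 1)) ℂ}
    (hΛ : Set.range γ ⊆ Set.range (embC 𝕜)) (hI : I.OrdConnected) (hI' : I.Nontrivial)
    (hγ : IsEmbedding γ) (hacc : ∀ z ∈ Set.range γ, AccPt z (𝓟 (Set.range γ)))
    (hDB : IsDB (m + 1) (starRingEnd ℂ) (Set.range γ)) (hφ : IsComposition γ φ) :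
    ContinuousOn φ (ssMatrices 𝕜 (m + 1) (Set.range γ)) := by
  induction hφ with
  | basic h =>
    obtain ⟨β, hβ, he⟩ := h.exists_eqOn_comp_toComplex hΛ
    exact ((hβ.continuousOn hI hI' hγ hacc hDB).comp continuous_toComplex.continuousOn
      fun X hX => toComplex_mem_ssMatrices.2 hX).congr he
  | comp hφ hψ ih =>
    exact (hψ.continuousOn hI hI' hγ hacc hDB).comp ih
      fun X hX => (hφ.mem_ssMatrices hΛ hγ.injective hX).1

theorem IsComposition.exists_extension {m : ℕ}
    {φ : Matrix (Fin (m + 1)) (Fin (m + 1)) 𝕜 → Matrix (Fin (m + 1)) (Fin (m + 1)) ℂ}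
    (hΛ : Set.range γ ⊆ Set.range (embC 𝕜)) (hI : I.OrdConnected) (hI' : I.Nontrivial)
    (hγ : IsEmbedding γ) (hacc : ∀ z ∈ Set.range γ, AccPt z (𝓟 (Set.range γ)))
    (hDC : IsDC (m + 1) (starRingEnd ℂ) (Set.range γ)) (hφ : IsComposition γ φ) :
    ∃ ψ : Matrix (Fin (m + 1)) (Fin (m + 1)) 𝕜 → Matrix (Fin (m + 1)) (Fin (m + 1)) ℂ,
      ContinuousOn ψ (arbMatrices 𝕜 (m + 1) (Set.range γ)) ∧
      Set.EqOn ψ φ (ssMatrices 𝕜 (m + 1) (Set.range γ)) ∧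
      Set.MapsTo ψ (arbMatrices 𝕜 (m + 1) (Set.range γ))
        (arbMatrices ℂ (m + 1) (Set.range γ)) := by
  induction hφ with
  | basic h =>
    obtain ⟨β, hβ, he⟩ := h.exists_eqOn_comp_toComplex hΛ
    obtain ⟨ψ, hψ, hψβ, hψm⟩ := hβ.exists_extension hI hI' hγ hacc hDC
    have hm : Set.MapsTo toComplex (arbMatrices 𝕜 (m + 1) (Set.range γ))
        (arbMatrices ℂ (m + 1) (Set.range γ)) := fun X hX => toComplex_mem_arbMatrices.2 hX
    refine ⟨fun X => ψ (toComplex X), hψ.comp continuous_toComplex.continuousOn hm,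
      fun X hX => ?_, fun X hX => hψm (hm hX)⟩
    rw [he hX]
    exact hψβ (toComplex_mem_ssMatrices.2 hX)
  | comp hφ hβ ih =>
    obtain ⟨χ, hχ, hχφ, hχm⟩ := ih
    obtain ⟨ψ, hψ, hψβ, hψm⟩ := hβ.exists_extension hI hI' hγ hacc hDC
    refine ⟨fun X => ψ (χ X), hψ.comp hχ hχm, fun X hX => ?_, fun X hX => hψm (hχm hX)⟩
    simp only [hχφ hX]
    exact hψβ (hφ.mem_ssMatrices hΛ hγ.injective hX).1

/-- If the curve is a point (or empty), there is at most one semisimple matrix. -/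
theorem subsingleton_ssMatrices (hI : I.Subsingleton) :
    (ssMatrices 𝕜 n (Set.range γ)).Subsingleton := by
  have key : ∀ X ∈ ssMatrices 𝕜 n (Set.range γ), ∀ t : I,
      toComplex X = diagonal fun _ => γ t := by
    rintro X ⟨hs, P, d, hP⟩ t
    rw [arbMatrices, Set.mem_ofPred_eq, hP,
      spectrum_subset_iff_of_charpoly (charpoly_conj_diagonal _ _)] at hs
    have hd : d = fun _ => γ t := by
      ext i
      obtain ⟨s, hs⟩ := hs i
      rw [← hs, Subtype.ext (hI s.2 t.2)]
    have hdiag : (diagonal fun _ => γ t : Matrix (Fin n) (Fin n) ℂ) = γ t • 1 := by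
      rw [smul_one_eq_diagonal]
    rw [hP, hd, hdiag, mul_smul_comm, mul_one, smul_mul_assoc, ← Units.val_mul, mul_inv_cancel,
      Units.val_one]
  intro X hX Y hY
  rcases isEmpty_or_nonempty (Fin n) with hn | ⟨⟨i⟩⟩
  · exact Subsingleton.elim X Y
  · obtain ⟨hs, P, d, hP⟩ := hX
    have hs' := hs
    rw [arbMatrices, Set.mem_ofPred_eq, hP,
      spectrum_subset_iff_of_charpoly (charpoly_conj_diagonal _ _)] at hs'
    obtain ⟨t, -⟩ := hs' i
    apply toComplex_injective
    rw [key X ⟨hs, P, d, hP⟩ t, key Y hY t]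

end Compositions

/-! ### Conditions on divided differences from continuity of `ρ` -/

section Necessity

open Polynomial Matrix

variable {𝕜 : Type*} [RCLike 𝕜] {m : ℕ}

/-- The matrix with diagonal `b` and the entries just above the diagonal equal to `ε`. -/
def bidiagonal {R : Type*} [Zero R] (b : Fin (m + 1) → R) (ε : R) :
    Matrix (Fin (m + 1)) (Fin (m + 1)) R :=
  of fun i j => if i = j then b i else if i.1 + 1 = j.1 then ε else 0

theorem charpoly_bidiagonal {R : Type*} [CommRing R] (b : Fin (m + 1) → R) (ε : R) :
    (bidiagonal b ε).charpoly = ∏ i, (Polynomial.X - C (b i)) := by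
  rw [charpoly_of_isUpperTriangular]
  · simp [bidiagonal]
  · intro i j hij
    have h1 : j < i := hij
    have h2 : j.1 < i.1 := h1
    simp only [bidiagonal, of_apply, if_neg h1.ne', if_neg (show ¬ i.1 + 1 = j.1 by omega)]

theorem toComplex_bidiagonal (b : Fin (m + 1) → 𝕜) (ε : 𝕜) :
    toComplex (bidiagonal b ε) = bidiagonal (fun i => embC 𝕜 (b i)) (embC 𝕜 ε) := by
  ext i j
  simp only [toComplex_apply, bidiagonal, of_apply]
  split_ifs <;> simp

/-- The first row of `∏_{i < k} (B - y_i)` for a bidiagonal matrix `B` is a multiple of a coordinate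
vector. -/
theorem aeval_bidiagonal_prod (y : ℕ → ℂ) (ε : ℂ) (k : ℕ) (hk : k ≤ m + 1) (j : Fin (m + 1)) :
    aeval (bidiagonal (fun i : Fin (m + 1) => y i) ε)
      (∏ i ∈ Finset.range k, (Polynomial.X - C (y i))) 0 j = if j.1 = k then ε ^ k else 0 := by
  induction k generalizing j with
  | zero =>
    simp only [Finset.range_zero, Finset.prod_empty, map_one, one_apply, pow_zero]
    congr 1
    exact propext (by rw [Fin.ext_iff, Fin.val_zero, eq_comm])
  | succ k ih =>
    rw [Finset.prod_range_succ, map_mul, mul_apply,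
      Finset.sum_eq_single (⟨k, by omega⟩ : Fin (m + 1))]
    · rw [ih (by omega), if_pos rfl, map_sub, aeval_X, aeval_C, Matrix.sub_apply,
        algebraMap_matrix_apply]
      simp only [bidiagonal, of_apply, Fin.ext_iff]
      by_cases h1 : k = j.1
      · simp [h1]
      · by_cases h2 : k + 1 = j.1
        · simp [← h2, pow_succ]
        · simp [h1, h2, Ne.symm h2]
    · intro l _ hl
      rw [ih (by omega), if_neg fun h => hl (Fin.ext h), zero_mul]
    · simp

theorem aeval_bidiagonal_newtonPoly (a y : ℕ → ℂ) (ε : ℂ) :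
    aeval (bidiagonal (fun i : Fin (m + 1) => y i) ε) (newtonPoly a y (m + 1)) 0 (Fin.last m) =
      a m * ε ^ m := by
  rw [newtonPoly, map_sum, Matrix.sum_apply, Finset.sum_eq_single m]
  · rw [map_mul, aeval_C, ← Algebra.smul_def, Matrix.smul_apply,
      aeval_bidiagonal_prod y ε m (by omega), if_pos (Fin.val_last m), smul_eq_mul]
  · intro k hk hkm
    have hk := Finset.mem_range.1 hk
    rw [map_mul, aeval_C, ← Algebra.smul_def, Matrix.smul_apply,
      aeval_bidiagonal_prod y ε k (by omega),
      if_neg (by rw [Fin.val_last]; exact fun h => hkm h.symm), smul_zero]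
  · simp

theorem continuous_bidiagonal {R : Type*} [Zero R] [TopologicalSpace R] :
    Continuous fun p : (Fin (m + 1) → R) × R => bidiagonal p.1 p.2 := by
  refine continuous_matrix fun i j => ?_
  simp only [bidiagonal, of_apply]
  split_ifs <;> fun_prop

/-- For a bidiagonal matrix with distinct eigenvalues, a corner entry of its image under `ρ` is, up to
conjugation and a scalar, a divided difference of complex conjugation. -/
theorem rho_bidiagonal_corner {Λ : Set ℂ} (hΛ : Λ ⊆ Set.range (embC 𝕜)) {y : Fin (m + 1) → ℂ}
    (hy : y ∈ configSpace (m + 1) Λ) (ε : ℝ) :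
    bidiagonal (fun i => RCLike.map ℂ 𝕜 (y i)) (ε : 𝕜) ∈ ssMatrices 𝕜 (m + 1) Λ ∧
    toComplex (rho Λ (bidiagonal (fun i => RCLike.map ℂ 𝕜 (y i)) (ε : 𝕜))) (Fin.last m) 0 =
      starRingEnd ℂ (iterDiffQuot (starRingEnd ℂ) m y * ε ^ m) := by
  let w : ℕ → ℂ := fun i => y (Fin.ofNat (m + 1) i)
  have hwy : ∀ i : Fin (m + 1), w i = y i := fun i => by
    simp only [w, Fin.ofNat_eq_cast, Fin.cast_val_eq_self]
  have hB : toComplex (bidiagonal (fun i => RCLike.map ℂ 𝕜 (y i)) (ε : 𝕜)) =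
      bidiagonal (fun i : Fin (m + 1) => w i) (ε : ℂ) := by
    rw [toComplex_bidiagonal]
    congr 1
    · ext i
      obtain ⟨z, hz⟩ := hΛ (hy.2 i)
      rw [hwy, ← hz, embC_leftInverse]
    · simp [embC_apply]
  have hinj : Set.InjOn w (Finset.range (m + 1) : Finset ℕ) := by
    intro i hi j hj hij
    have hi : i < m + 1 := by simpa using hi
    have hj : j < m + 1 := by simpa using hj
    have h1 := congrArg Fin.val (hy.1 hij)
    rwa [Fin.val_ofNat, Fin.val_ofNat, Nat.mod_eq_of_lt hi, Nat.mod_eq_of_lt hj] at h1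
  obtain ⟨h1, h2⟩ := rho_eq_aeval_newtonPoly hinj (fun i _ => hy.2 _)
    (charpoly_bidiagonal (fun i : Fin (m + 1) => w i) (ε : ℂ))
  rw [← hB, toComplex_mem_ssMatrices] at h1
  refine ⟨h1, ?_⟩
  rw [toComplex_rho hΛ h1, hB, h2, conjTranspose_apply, aeval_bidiagonal_newtonPoly, divDiff]
  simp only [hwy]
  rfl

theorem isDB_of_continuousOn_rho {Λ : Set ℂ} (hΛ : Λ ⊆ Set.range (embC 𝕜)) (hm : 1 ≤ m)
    (h : ContinuousOn (fun X : Matrix (Fin (m + 1)) (Fin (m + 1)) 𝕜 => toComplex (rho Λ X))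
      (ssMatrices 𝕜 (m + 1) Λ)) : IsDB (m + 1) (starRingEnd ℂ) Λ := by
  intro x hxΛ _
  change ∃ C : ℝ, ∀ᶠ y in 𝓝[configSpace (m + 1) Λ] (fun _ => x),
    ‖iterDiffQuot (starRingEnd ℂ) m y‖ ≤ C
  obtain ⟨ξ, rfl⟩ := hΛ hxΛ
  let B : ℝ × (Fin (m + 1) → ℂ) → Matrix (Fin (m + 1)) (Fin (m + 1)) 𝕜 := fun p =>
    bidiagonal (fun i => RCLike.map ℂ 𝕜 (p.2 i)) (p.1 : 𝕜)
  have hBc : Continuous B := by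
    refine continuous_bidiagonal.comp (Continuous.prodMk (continuous_pi fun i => ?_) ?_)
    · exact (RCLike.map ℂ 𝕜).continuous.comp ((continuous_apply i).comp continuous_snd)
    · exact RCLike.continuous_ofReal.comp continuous_fst
  have hB0 : B (0, fun _ => embC 𝕜 ξ) = diagonal fun _ => ξ := by
    ext i j
    simp only [B, bidiagonal, of_apply, embC_leftInverse ξ, diagonal_apply]
    simp
  have hmem : diagonal (fun _ => ξ) ∈ ssMatrices 𝕜 (m + 1) Λ := by
    simpa using conj_diagonal_mem_ssMatrices (𝕜 := 𝕜) (Λ := Λ) (1 : GL (Fin (m + 1)) 𝕜)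
      (d := fun _ => ξ) fun _ => hxΛ
  have hrho : rho Λ (diagonal fun _ : Fin (m + 1) => ξ) = diagonal fun _ => ξ := by
    simpa using rho_conj_diagonal (𝕜 := 𝕜) (Λ := Λ) (1 : GL (Fin (m + 1)) 𝕜)
      (d := fun _ => ξ) fun _ => hxΛ
  have hF : ∀ᶠ X in 𝓝 (diagonal fun _ : Fin (m + 1) => ξ), X ∈ ssMatrices 𝕜 (m + 1) Λ →
      ‖toComplex (rho Λ X) (Fin.last m) 0‖ < 1 := by
    have h1 : Tendsto (fun X => ‖toComplex (rho Λ X) (Fin.last m) 0‖)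
        (𝓝[ssMatrices 𝕜 (m + 1) Λ] diagonal fun _ => ξ)
        (𝓝 ‖toComplex (rho Λ (diagonal fun _ => ξ)) (Fin.last m) 0‖) :=
      ((continuous_id.matrix_elem (Fin.last m) (0 : Fin (m + 1))).norm.tendsto _).comp (h _ hmem)
    rw [← eventually_nhdsWithin_iff]
    refine h1.eventually (gt_mem_nhds ?_)
    have hne : Fin.last m ≠ 0 := fun h => by
      have := congrArg Fin.val h
      simp at this
      omega
    rw [hrho, toComplex_diagonal, diagonal_apply_ne _ hne, norm_zero]
    exact one_pos
  rw [← hB0] at hF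
  have h2 := (hBc.tendsto _).eventually hF
  rw [nhds_prod_eq] at h2
  -- a fixed non-zero superdiagonal is small enough for all tuples near the constant one
  obtain ⟨ε, hε, hε0⟩ := ((h2.curry.filter_mono nhdsWithin_le_nhds).and
    (self_mem_nhdsWithin : Set.Ioi (0 : ℝ) ∈ 𝓝[>] 0)).exists
  have hε0 : 0 < ε := hε0
  refine ⟨1 / ε ^ m, ?_⟩
  rw [eventually_nhdsWithin_iff]
  refine hε.mono fun y hy hyc => ?_
  obtain ⟨h3, h4⟩ := rho_bidiagonal_corner hΛ hyc ε
  have h5 := hy h3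
  simp only [B] at h5
  rw [h4, RCLike.norm_conj, norm_mul, norm_pow, Complex.norm_real, Real.norm_of_nonneg hε0.le] at h5
  rw [le_div_iff₀ (by positivity)]
  exact h5.le

theorem isDC_of_extendsContinuously_rho {Λ : Set ℂ} (hΛ : Λ ⊆ Set.range (embC 𝕜))
    (h : ExtendsContinuously (ssMatrices 𝕜 (m + 1) Λ) (arbMatrices 𝕜 (m + 1) Λ)
      (fun X => toComplex (rho Λ X))) : IsDC (m + 1) (starRingEnd ℂ) Λ := by
  intro x hxΛ _
  change ∃ L : ℂ, Tendsto (iterDiffQuot (starRingEnd ℂ) m)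
    (𝓝[configSpace (m + 1) Λ] (fun _ => x)) (𝓝 L)
  obtain ⟨ψ, hψ, hψe⟩ := h
  obtain ⟨ξ, rfl⟩ := hΛ hxΛ
  let B : (Fin (m + 1) → ℂ) → Matrix (Fin (m + 1)) (Fin (m + 1)) 𝕜 := fun y =>
    bidiagonal (fun i => RCLike.map ℂ 𝕜 (y i)) ((1 : ℝ) : 𝕜)
  have hBc : Continuous B := by
    refine continuous_bidiagonal.comp (Continuous.prodMk (continuous_pi fun i => ?_)
      continuous_const)
    exact (RCLike.map ℂ 𝕜).continuous.comp (continuous_apply i)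
  have hJ : B (fun _ => embC 𝕜 ξ) ∈ arbMatrices 𝕜 (m + 1) Λ := by
    rw [arbMatrices, Set.mem_ofPred_eq, toComplex_bidiagonal,
      spectrum_subset_iff_of_charpoly (charpoly_bidiagonal _ _)]
    intro i
    rwa [embC_leftInverse]
  have hBt : Tendsto B (𝓝[configSpace (m + 1) Λ] (fun _ => embC 𝕜 ξ))
      (𝓝[arbMatrices 𝕜 (m + 1) Λ] (B fun _ => embC 𝕜 ξ)) :=
    tendsto_nhdsWithin_iff.2 ⟨(hBc.tendsto _).mono_left nhdsWithin_le_nhds,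
      eventually_nhdsWithin_of_forall fun y hy => (rho_bidiagonal_corner hΛ hy 1).1.1⟩
  have h1 := (((Complex.continuous_conj.comp
    (continuous_id.matrix_elem (Fin.last m) (0 : Fin (m + 1)))).tendsto _).comp (hψ _ hJ)).comp hBt
  refine ⟨_, h1.congr' (eventually_nhdsWithin_of_forall fun y hy => ?_)⟩
  obtain ⟨h3, h4⟩ := rho_bidiagonal_corner hΛ hy 1
  change starRingEnd ℂ (ψ (B y) (Fin.last m) 0) = _
  have h5 : ψ (B y) = toComplex (rho Λ (B y)) := hψe h3
  rw [h5, h4, Complex.conj_conj]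
  simp

end Necessity

/-! ### Cluster points of the curve -/

theorem accPt_range {I : Set ℝ} (hI : I.OrdConnected) (hI' : I.Nontrivial) {γ : I → ℂ}
    (hγ : Continuous γ) (hinj : Function.Injective γ) :
    ∀ z ∈ Set.range γ, AccPt z (𝓟 (Set.range γ)) := by
  have : PreconnectedSpace I := Subtype.preconnectedSpace hI.isPreconnected
  obtain ⟨a, ha, b, hb, hab⟩ := hI'
  refine (isPreconnected_range hγ).preperfect_of_nontrivial
    ⟨γ ⟨a, ha⟩, ⟨_, rfl⟩, γ ⟨b, hb⟩, ⟨_, rfl⟩, fun h => hab ?_⟩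
  exact congrArg Subtype.val (hinj h)

end CurveSpectra

/-! ### Continuity and continuous extension of all compositions -/

theorem theorem3 {𝕜 : Type*} [RCLike 𝕜] (n : ℕ) (hn : 2 ≤ n)
    (I : Set ℝ) (hI : I.OrdConnected) (γ : I → 𝕜) (hγ : Continuous γ)
    (hinj : Function.Injective γ)
    -- the curve as a subset of the complex plane
    (γc : I → ℂ) (hγc : γc = fun t => RCLike.map 𝕜 ℂ (γ t))
    (Λ : Set ℂ) (hΛ : Λ = Set.range γc) :
    -- (1), first the fact that `ρ` is a well-defined involution
    ((∀ X ∈ CurveSpectra.ssMatrices 𝕜 n Λ, ∃ R N : Matrix (Fin n) (Fin n) 𝕜,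
        R.PosDef ∧ N ∈ CurveSpectra.normalMatrices 𝕜 n Λ ∧ X = R * N * R⁻¹) ∧
      (∀ R N : Matrix (Fin n) (Fin n) 𝕜,
        R.PosDef → N ∈ CurveSpectra.normalMatrices 𝕜 n Λ →
          R * N * R⁻¹ ∈ CurveSpectra.ssMatrices 𝕜 n Λ ∧
          CurveSpectra.rho Λ (R * N * R⁻¹) = R⁻¹ * N * R) ∧
      (∀ X ∈ CurveSpectra.ssMatrices 𝕜 n Λ,
        CurveSpectra.rho Λ X ∈ CurveSpectra.ssMatrices 𝕜 n Λ ∧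
        CurveSpectra.rho Λ (CurveSpectra.rho Λ X) = X) ∧
      (∀ φ : Matrix (Fin n) (Fin n) 𝕜 → Matrix (Fin n) (Fin n) ℂ,
        CurveSpectra.IsComposition γc φ →
          Set.MapsTo φ (CurveSpectra.ssMatrices 𝕜 n Λ) (CurveSpectra.ssMatrices ℂ n Λ) ∧
          CurveSpectra.PreservesCommutativity (CurveSpectra.ssMatrices 𝕜 n Λ) φ ∧
          CurveSpectra.PreservesSpectrum (CurveSpectra.ssMatrices 𝕜 n Λ) φ)) ∧
    (Topology.IsEmbedding γ →
      -- (2)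
      ((∀ φ : Matrix (Fin n) (Fin n) 𝕜 → Matrix (Fin n) (Fin n) ℂ,
          CurveSpectra.IsComposition γc φ →
            ContinuousOn φ (CurveSpectra.ssMatrices 𝕜 n Λ)) ↔
        CurveSpectra.IsDB n (starRingEnd ℂ) Λ) ∧
      -- (3)
      ((∀ φ : Matrix (Fin n) (Fin n) 𝕜 → Matrix (Fin n) (Fin n) ℂ,
          CurveSpectra.IsComposition γc φ →
            CurveSpectra.ExtendsContinuously (CurveSpectra.ssMatrices 𝕜 n Λ)
              (CurveSpectra.arbMatrices 𝕜 n Λ) φ) ↔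
        CurveSpectra.IsDC n (starRingEnd ℂ) Λ)) := by
  obtain ⟨m, rfl⟩ : ∃ m, n = m + 1 := ⟨n - 1, by omega⟩
  have hΛr : Λ ⊆ Set.range (CurveSpectra.embC 𝕜) := by
    rw [hΛ, hγc]
    rintro _ ⟨t, rfl⟩
    exact ⟨γ t, rfl⟩
  have hinjc : Function.Injective γc := by
    rw [hγc]
    exact CurveSpectra.embC_injective.comp hinj
  have hcc : Continuous γc := by
    rw [hγc]
    exact CurveSpectra.continuous_embC.comp hγ
  refine ⟨⟨fun X hX => CurveSpectra.exists_posDef_normal hΛr hX,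
    fun R N hR hN => ⟨CurveSpectra.posDef_conj_mem_ssMatrices hR hN,
      CurveSpectra.rho_posDef_conj hR hN⟩,
    fun X hX => CurveSpectra.rho_mem_ssMatrices hΛr hX, fun φ hφ => ?_⟩, fun hemb => ?_⟩
  · subst hΛ
    refine ⟨fun X hX => (hφ.mem_ssMatrices hΛr hinjc hX).1,
      fun X hX Y hY h => hφ.commute hΛr hinjc hX hY h, fun X hX => ?_⟩
    have h := (hφ.mem_ssMatrices hΛr hinjc hX).2
    exact ⟨CurveSpectra.spectrum_eq_of_charpoly_eq h, h⟩
  have hembc : IsEmbedding γc := by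
    rw [hγc]
    exact (CurveSpectra.embC_leftInverse.isEmbedding (RCLike.map ℂ 𝕜).continuous
      CurveSpectra.continuous_embC).comp hemb
  subst hΛ
  refine ⟨⟨fun h => CurveSpectra.isDB_of_continuousOn_rho hΛr (by omega) (h _ (.basic .rho)),
    fun hDB φ hφ => ?_⟩, ⟨fun h =>
      CurveSpectra.isDC_of_extendsContinuously_rho hΛr (h _ (.basic .rho)), fun hDC φ hφ => ?_⟩⟩
  all_goals
    rcases I.subsingleton_or_nontrivial with hI' | hI'
  · exact (CurveSpectra.subsingleton_ssMatrices hI').continuousOn φ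
  · exact hφ.continuousOn hΛr hI hI' hembc (CurveSpectra.accPt_range hI hI' hcc hinjc) hDB
  · -- the value at the only semisimple matrix, if any, extends as a constant
    rcases (CurveSpectra.subsingleton_ssMatrices (𝕜 := 𝕜) (n := m + 1) (γ := γc)
      hI').eq_empty_or_singleton with h | ⟨X, h⟩
    · exact ⟨0, continuousOn_const, by rw [h]; exact Set.eqOn_empty _ _⟩
    · exact ⟨fun _ => φ X, continuousOn_const, by rw [h]; rintro _ rfl; rfl⟩
  · obtain ⟨ψ, hψ, hψφ, -⟩ := hφ.exists_extension hΛr hI hI' hembc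
      (CurveSpectra.accPt_range hI hI' hcc hinjc) hDC
    exact ⟨ψ, hψ, hψφ⟩
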